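/- **Theorem 5.1.** For $\mu>0$ let $H^{\mu}(\mathbb R)$ be the space of real-valued $w\in L^2(\mathbb R)$ with $|\omega|^{\mu}\mathcal F(w)\in L^2(\mathbb R)$, with norm $\|w\|_{H^\mu}=\bigl(\|w\|_{L^2(\mathbb R)}^2+\||\omega|^{\mu}\mathcal F(w)\|_{L^2(\mathbb R)}^2\bigr)^{1/2}$, where $\mathcal F$ is the unitary Fourier transform in the angular frequency $\omega$. Let $H^{\mu}_0(0,1)$ be the completion of $C_0^\infty(0,1)$ in this norm, and let $H^{-1}(0,1)$ be the dual of $H^1_0(0,1)$ with the dual norm. For $0<\beta<1$ and $0\le\theta\le1$ put $$I^\beta_\theta w(x)=\frac{\theta}{\Gamma(\beta)}\int_0^x\frac{w(s)}{(x-s)^{1-\beta}}\,ds+\frac{1-\theta}{\Gamma(\beta)}\int_x^1\frac{w(s)}{(s-x)^{1-\beta}}\,ds,\qquad x\in(0,1),$$ and $A(w,v)=(D I^\beta_\theta w, Dv)_{L^2(0,1)}$, where $D$ is the weak derivative on $(0,1)$. Let $0<\beta<1/2$. There are constants $\kappa=\kappa(\beta)>0$ and $C=C(\beta)$ such that for every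 $0\le\theta\le1$ the following hold. 1. $I^\beta_\theta w\in H^1(0,1)$ for all $w\in H^{1-\beta}_0(0,1)$, and $A$ is a bounded bilinear form on $H^{1-\beta}_0(0,1)\times H^1_0(0,1)$, with $|A(w,v)|\le C\|w\|_{H^{1-\beta}}\|v\|_{H^1}$. 2. $A$ is weakly coercive: $$\inf_{w\in H^{1-\beta}_0(0,1)\setminus\{0\}}\ \sup_{v\in H^1_0(0,1)\setminus\{0\}}\frac{A(w,v)}{\|w\|_{H^{1-\beta}}\|v\|_{H^1}}\ge\kappa,\qquad \sup_{w\in H^{1-\beta}_0(0,1)}A(w,v)>0\quad\text{for all } v\in H^1_0(0,1)\setminus\{0\}.$$ 3. For every $f\in H^{-1}(0,1)$ there is a unique $u\in H^{1-\beta}_0(0,1)$ with $A(u,v)=\langle f,v\rangle$ for all $v\in H^1_0(0,1)$, and it satisfies $\|u\|_{H^{1-\beta}}\le\kappa^{-1}\|f\|_{H^{-1}}$. -/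

import Mathlib

open MeasureTheory Set
open scoped FourierTransform ContDiff ENNReal

noncomputable section

namespace FracPG

/-- The complexification of a real-valued `L²(ℝ)` function. -/
def complexify : Lp ℝ 2 (volume : Measure ℝ) →L[ℝ] Lp ℂ 2 (volume : Measure ℝ) :=
  Complex.ofRealCLM.compLpL 2 volume

/-- The (Plancherel) Fourier transform of a real-valued `L²(ℝ)` function, in the normalization
`𝓕 w ξ = ∫ x, exp (-2 π i x ξ) w x`. The angular frequency is `ω = 2 π ξ`. -/
def fourierL2 (w : Lp ℝ 2 (volume : Measure ℝ)) : Lp ℂ 2 (volume : Measure ℝ) :=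
  𝓕 (complexify w)

/-- The function `ξ ↦ |ω| ^ μ * 𝓕 w ξ` with `ω = 2 π ξ`, whose `L²` norm is the seminorm of
`H^μ(ℝ)`. -/
def weightedFourier (μ : ℝ) (w : Lp ℝ 2 (volume : Measure ℝ)) : ℝ → ℂ :=
  fun ξ => ((|2 * Real.pi * ξ| ^ μ : ℝ) : ℂ) * fourierL2 w ξ

theorem fourierL2_add (w z : Lp ℝ 2 (volume : Measure ℝ)) :
    fourierL2 (w + z) = fourierL2 w + fourierL2 z := by
  simp [fourierL2, FourierTransform.fourier_add]

theorem fourierL2_smul (c : ℝ) (w : Lp ℝ 2 (volume : Measure ℝ)) :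
    fourierL2 (c • w) = (c : ℂ) • fourierL2 w := by
  have h : complexify (c • w) = (c : ℂ) • complexify w := by
    rw [map_smul]; rfl
  rw [fourierL2, h, FourierTransform.fourier_smul]; rfl

theorem weightedFourier_add (μ : ℝ) (w z : Lp ℝ 2 (volume : Measure ℝ)) :
    weightedFourier μ (w + z) =ᵐ[volume] weightedFourier μ w + weightedFourier μ z := by
  unfold weightedFourier
  rw [fourierL2_add]
  filter_upwards [Lp.coeFn_add (fourierL2 w) (fourierL2 z)] with ξ h
  simp only [Pi.add_apply] at h ⊢
  rw [h, mul_add]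

theorem weightedFourier_smul (μ c : ℝ) (w : Lp ℝ 2 (volume : Measure ℝ)) :
    weightedFourier μ (c • w) =ᵐ[volume] c • weightedFourier μ w := by
  unfold weightedFourier
  rw [fourierL2_smul]
  filter_upwards [Lp.coeFn_smul (c : ℂ) (fourierL2 w)] with ξ h
  simp only [Pi.smul_apply, smul_eq_mul, Complex.real_smul] at h ⊢
  rw [h, mul_left_comm]

/-- The set of (real-valued) functions of `H^μ(ℝ)`: those `w ∈ L²(ℝ)` with
`|ω| ^ μ * 𝓕 w ∈ L²(ℝ)`. -/
def sobolevSubmodule (μ : ℝ) : Submodule ℝ (Lp ℝ 2 (volume : Measure ℝ)) where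
  carrier := {w | MemLp (weightedFourier μ w) 2 volume}
  zero_mem' := by
    have h := weightedFourier_smul μ 0 0
    simp only [zero_smul] at h
    exact (memLp_congr_ae h).2 MemLp.zero
  add_mem' {w z} hw hz := (memLp_congr_ae (weightedFourier_add μ w z)).2 (MemLp.add hw hz)
  smul_mem' c w hw := (memLp_congr_ae (weightedFourier_smul μ c w)).2 (MemLp.const_smul hw c)

/-- The fractional Sobolev space `H^μ(ℝ)` of real-valued functions. It carries the norm
`(‖w‖² + ‖|ω| ^ μ * 𝓕 w‖²) ^ (1/2)` (norms of `L²(ℝ)`), not the norm of `L²(ℝ)`. -/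
def SobolevR (μ : ℝ) : Type := ↥(sobolevSubmodule μ)

namespace SobolevR

variable {μ : ℝ}

instance : AddCommGroup (SobolevR μ) := inferInstanceAs (AddCommGroup ↥(sobolevSubmodule μ))

instance : Module ℝ (SobolevR μ) := inferInstanceAs (Module ℝ ↥(sobolevSubmodule μ))

/-- The inclusion `H^μ(ℝ) ⊆ L²(ℝ)`. -/
def toL2 : SobolevR μ →ₗ[ℝ] Lp ℝ 2 (volume : Measure ℝ) := (sobolevSubmodule μ).subtype

theorem toL2_injective : Function.Injective (toL2 (μ := μ)) := Subtype.val_injective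

theorem memLp_weighted (w : SobolevR μ) : MemLp (weightedFourier μ (toL2 w)) 2 volume := w.2

/-- `|ω| ^ μ * 𝓕 w` as an element of `L²(ℝ)`. -/
def weighted : SobolevR μ →ₗ[ℝ] Lp ℂ 2 (volume : Measure ℝ) where
  toFun w := MemLp.toLp (weightedFourier μ (toL2 w)) (memLp_weighted w)
  map_add' w z := by
    refine Eq.trans ?_ (MemLp.toLp_add (memLp_weighted w) (memLp_weighted z))
    exact MemLp.toLp_congr _ _ (by rw [map_add]; exact weightedFourier_add μ _ _)
  map_smul' c w := by
    refine Eq.trans ?_ (MemLp.toLp_const_smul c (memLp_weighted w))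
    exact MemLp.toLp_congr _ _ (by rw [map_smul]; exact weightedFourier_smul μ c _)

/-- `w ↦ (w, |ω| ^ μ * 𝓕 w)`, which induces the norm of `H^μ(ℝ)`. -/
def graphMap : SobolevR μ →ₗ[ℝ]
    WithLp 2 (Lp ℝ 2 (volume : Measure ℝ) × Lp ℂ 2 (volume : Measure ℝ)) :=
  (WithLp.linearEquiv 2 ℝ
    (Lp ℝ 2 (volume : Measure ℝ) × Lp ℂ 2 (volume : Measure ℝ))).symm.toLinearMap ∘ₗ
      (toL2.prod weighted)

theorem graphMap_injective : Function.Injective (graphMap (μ := μ)) := by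
  intro w z h
  have h' := (WithLp.linearEquiv 2 ℝ
    (Lp ℝ 2 (volume : Measure ℝ) × Lp ℂ 2 (volume : Measure ℝ))).symm.injective h
  exact toL2_injective (congrArg Prod.fst h')

instance : NormedAddCommGroup (SobolevR μ) :=
  NormedAddCommGroup.induced (SobolevR μ)
    (WithLp 2 (Lp ℝ 2 (volume : Measure ℝ) × Lp ℂ 2 (volume : Measure ℝ)))
    graphMap graphMap_injective

instance : NormedSpace ℝ (SobolevR μ) :=
  NormedSpace.induced ℝ (SobolevR μ)
    (WithLp 2 (Lp ℝ 2 (volume : Measure ℝ) × Lp ℂ 2 (volume : Measure ℝ))) graphMap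

theorem norm_sq_eq (w : SobolevR μ) : ‖w‖ ^ 2 = ‖toL2 w‖ ^ 2 + ‖weighted w‖ ^ 2 :=
  WithLp.prod_norm_sq_eq_of_L2 (graphMap w)

end SobolevR

/-- `φ ∈ C_0^∞(0,1)`: smooth, with compact support contained in the open interval `(0,1)`. -/
structure IsTestFunction (φ : ℝ → ℝ) : Prop where
  smooth : ContDiff ℝ ∞ φ
  hasCompactSupport : HasCompactSupport φ
  tsupport_subset : tsupport φ ⊆ Ioo 0 1

theorem IsTestFunction.zero : IsTestFunction 0 :=
  ⟨contDiff_const, HasCompactSupport.zero, by simp⟩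

theorem IsTestFunction.add {φ ψ : ℝ → ℝ} (hφ : IsTestFunction φ) (hψ : IsTestFunction ψ) :
    IsTestFunction (φ + ψ) :=
  ⟨hφ.smooth.add hψ.smooth, hφ.hasCompactSupport.add hψ.hasCompactSupport,
    (tsupport_add φ ψ).trans (union_subset hφ.tsupport_subset hψ.tsupport_subset)⟩

theorem IsTestFunction.smul (c : ℝ) {φ : ℝ → ℝ} (hφ : IsTestFunction φ) :
    IsTestFunction (c • φ) :=
  ⟨contDiff_const.smul hφ.smooth, hφ.hasCompactSupport.smul_left (f := fun _ => c),
    (tsupport_smul_subset_right (fun _ => c) φ).trans hφ.tsupport_subset⟩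

/-- `C_0^∞(0,1)` as a subspace of `H^μ(ℝ)`. -/
def testSubmodule (μ : ℝ) : Submodule ℝ (SobolevR μ) where
  carrier := {w | ∃ φ, IsTestFunction φ ∧ SobolevR.toL2 w =ᵐ[volume] φ}
  zero_mem' := ⟨0, .zero, by rw [map_zero]; exact Lp.coeFn_zero _ _ _⟩
  add_mem' {w z} := by
    rintro ⟨φ, hφ, hw⟩ ⟨ψ, hψ, hz⟩
    refine ⟨φ + ψ, hφ.add hψ, ?_⟩
    rw [map_add]
    exact (Lp.coeFn_add _ _).trans (hw.add hz)
  smul_mem' c w := by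
    rintro ⟨φ, hφ, hw⟩
    refine ⟨c • φ, hφ.smul c, ?_⟩
    rw [map_smul]
    exact (Lp.coeFn_smul _ _).trans (hw.const_smul c)

/-- `H^μ_0(0,1)`: the completion of `C_0^∞(0,1)` in the norm of `H^μ(ℝ)`, i.e. its closure in
the space `H^μ(ℝ)`. -/
abbrev SobolevZero (μ : ℝ) : Type := ↥(testSubmodule μ).topologicalClosure

/-- The function `ℝ → ℝ` (vanishing a.e. outside `(0,1)`) given by an element of `H^μ_0(0,1)`. -/
def SobolevZero.fn {μ : ℝ} (w : SobolevZero μ) : ℝ → ℝ := SobolevR.toL2 (w : SobolevR μ)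

/-- `g` is the weak derivative of `u` on `(0,1)`. -/
def HasWeakDeriv (u g : ℝ → ℝ) : Prop :=
  LocallyIntegrableOn u (Ioo 0 1) ∧ LocallyIntegrableOn g (Ioo 0 1) ∧
    ∀ φ, IsTestFunction φ →
      ∫ x in Ioo (0 : ℝ) 1, u x * deriv φ x = -∫ x in Ioo (0 : ℝ) 1, g x * φ x

/-- `u ∈ H^1(0,1)`: `u` and its weak derivative are in `L²(0,1)`. -/
def MemSobolevOne (u : ℝ → ℝ) : Prop :=
  MemLp u 2 (volume.restrict (Ioo 0 1)) ∧
    ∃ g, HasWeakDeriv u g ∧ MemLp g 2 (volume.restrict (Ioo 0 1))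

open Classical in
/-- `D u`, the weak derivative of `u` on `(0,1)` (which is unique almost everywhere), with the
default value `0` if there is none. -/
def weakDeriv (u : ℝ → ℝ) : ℝ → ℝ :=
  if h : ∃ g, HasWeakDeriv u g then h.choose else 0

/-- The left fractional integral of order `σ` on `(0,1)`. -/
def leftFracInt (σ : ℝ) (w : ℝ → ℝ) (x : ℝ) : ℝ :=
  1 / Real.Gamma σ * ∫ s in Ioo 0 x, w s / (x - s) ^ (1 - σ)

/-- The right fractional integral of order `σ` on `(0,1)`. -/
def rightFracInt (σ : ℝ) (w : ℝ → ℝ) (x : ℝ) : ℝ :=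
  1 / Real.Gamma σ * ∫ s in Ioo x 1, w s / (s - x) ^ (1 - σ)

/-- The two-sided fractional integral operator `I^β_θ`. -/
def twoSidedFracInt (β θ : ℝ) (w : ℝ → ℝ) (x : ℝ) : ℝ :=
  θ * leftFracInt β w x + (1 - θ) * rightFracInt β w x

/-- The Petrov-Galerkin form `A(w,v) = (D I^β_θ w, D v)_{L²(0,1)}` (diffusivity `K = 1`). -/
def pgForm (β θ : ℝ) (w : SobolevZero (1 - β)) (v : SobolevZero 1) : ℝ :=
  ∫ x in Ioo (0 : ℝ) 1, weakDeriv (twoSidedFracInt β θ w.fn) x * weakDeriv v.fn x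

/-- `H^{-1}(0,1)`: the dual space of `H^1_0(0,1)`, with the dual norm. -/
abbrev SobolevMinusOne : Type := StrongDual ℝ (SobolevZero 1)

/-- `u` solves the Petrov-Galerkin problem with right-hand side `f`. -/
def IsPGSolution (β θ : ℝ) (f : SobolevMinusOne) (u : SobolevZero (1 - β)) : Prop :=
  ∀ v : SobolevZero 1, pgForm β θ u v = f v

end FracPG

end

/-!
The left and right fractional derivatives `D I^β_1` and `D I^β_0` are limits, as `ε → 0`, of Fourier
multipliers by `iω (ε + iω) ^ (-β)` and `iω (ε - iω) ^ (-β)`. Hence both are bounded by the seminorm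
of `H^{1-β}`, and the angle between their values at the same function is at most `πβ`, which is
acute for `β < 1/2`. So `w ↦ D I^β_θ w` is bounded below, but weak coercivity requires more: by
du Bois-Reymond's lemma the constants are the orthogonal complement of `D (H^1_0(0,1))` in
`L²(0,1)`, and `D I^β_θ w` must stay away from them.

This is ensured by a function orthogonal to the range of `D I^β_θ`, namely
`h(s) = s ^ (p - 1) * (1 - s) ^ (q - 1)` with `p + q = 2 - β` and
`(1 - θ) sin (π q) = θ sin (π p)`: Euler's integral and the reflection formula show that
`I^β_{1-θ} h` is constant. As `h` is positive and lies in `L²(0,1)` for `β < 1/2`, any vector can be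
corrected by a multiple of `h` so as to become orthogonal to the constants without changing its
inner product with `D I^β_θ w`. Applied to the sum of the two one-sided derivatives this gives the
inf-sup condition.

The form is nondegenerate in `v` because `A(v, v)` is at least `cos (πβ/2)` times the squared
`H^{1-β/2}` seminorm of `v`, and well-posedness is then Babuška's theorem.
-/

noncomputable section

namespace FracPG

open Filter Topology Real

theorem integrableOn_rpow_mul_exp_neg_mul {s ε : ℝ} (hs : -1 < s) (hε : 0 < ε) :
    IntegrableOn (fun t : ℝ => t ^ s * exp (-(ε * t))) (Ioi 0) := by
  simpa only [rpow_one, neg_mul] using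
    integrableOn_rpow_mul_exp_neg_mul_rpow (s := s) (p := 1) hs one_pos hε

/-- The measure on the half-line with density `t ^ s`, encoding power-weighted Laplace transforms
as complex moment generating functions. -/
def rpowMeasure (s : ℝ) : Measure ℝ :=
  (volume.restrict (Ioi (0 : ℝ))).withDensity fun t => ENNReal.ofReal (t ^ s)

theorem complexMGF_rpowMeasure (s : ℝ) (z : ℂ) :
    ProbabilityTheory.complexMGF (fun t => -t) (rpowMeasure s) z =
      ∫ t in Ioi (0 : ℝ), ((t ^ s : ℝ) : ℂ) * Complex.exp (-(z * t)) := by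
  rw [ProbabilityTheory.complexMGF, rpowMeasure,
    integral_withDensity_eq_integral_toReal_smul (by fun_prop)
      (Eventually.of_forall fun _ => ENNReal.ofReal_lt_top)]
  refine setIntegral_congr_fun measurableSet_Ioi fun t ht => ?_
  simp [ENNReal.toReal_ofReal (rpow_nonneg (le_of_lt ht) s)]

theorem Ioi_subset_integrableExpSet_rpowMeasure {s : ℝ} (hs : -1 < s) :
    Ioi 0 ⊆ ProbabilityTheory.integrableExpSet (fun t => -t) (rpowMeasure s) := by
  intro ε hε
  refine (integrable_withDensity_iff_integrable_smul' (by fun_prop)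
    (Eventually.of_forall fun _ => ENNReal.ofReal_lt_top)).2 ?_
  refine (integrableOn_rpow_mul_exp_neg_mul hs hε).congr_fun (fun t ht => ?_) measurableSet_Ioi
  simp [ENNReal.toReal_ofReal (rpow_nonneg (le_of_lt ht) s)]

theorem analyticOnNhd_laplace_rpow {s : ℝ} (hs : -1 < s) :
    AnalyticOnNhd ℂ (fun z => ∫ t in Ioi (0 : ℝ), ((t ^ s : ℝ) : ℂ) * Complex.exp (-(z * t)))
      {z | 0 < z.re} := by
  refine AnalyticOnNhd.congr ?_ (ProbabilityTheory.analyticOnNhd_complexMGF.mono fun z hz => ?_)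
    (fun z _ => complexMGF_rpowMeasure s z)
  · exact isOpen_lt continuous_const Complex.continuous_re
  · exact interior_maximal (Ioi_subset_integrableExpSet_rpowMeasure hs) isOpen_Ioi hz

theorem integral_rpow_mul_cexp_neg_mul_Ioi {a : ℝ} (ha : 0 < a) {z : ℂ} (hz : 0 < z.re) :
    ∫ t in Ioi (0 : ℝ), ((t ^ (a - 1) : ℝ) : ℂ) * Complex.exp (-(z * t)) =
      Gamma a * z ^ (-a : ℂ) := by
  have hpow : AnalyticOnNhd ℂ (fun z : ℂ => (Gamma a : ℂ) * z ^ (-a : ℂ)) {z | 0 < z.re} :=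
    fun z hz => analyticAt_const.mul (analyticAt_id.cpow analyticAt_const (Or.inl hz))
  have heq_real : ∀ r : ℝ, 0 < r →
      ∫ t in Ioi (0 : ℝ), ((t ^ (a - 1) : ℝ) : ℂ) * Complex.exp (-(r * t)) =
        Gamma a * (r : ℂ) ^ (-a : ℂ) := by
    intro r hr
    have h := integral_rpow_mul_exp_neg_mul_Ioi ha hr
    rw [one_div, inv_rpow hr.le, ← rpow_neg hr.le, mul_comm] at h
    rw [← Complex.ofReal_neg, ← Complex.ofReal_cpow hr.le, ← Complex.ofReal_mul, ← h,
      ← integral_complex_ofReal]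
    simp
  have hfreq : ∃ᶠ z in 𝓝[≠] (1 : ℂ),
      ∫ t in Ioi (0 : ℝ), ((t ^ (a - 1) : ℝ) : ℂ) * Complex.exp (-(z * t)) =
        Gamma a * z ^ (-a : ℂ) := by
    have hmap : Tendsto Complex.ofReal (𝓝[>] (1 : ℝ)) (𝓝[≠] 1) :=
      tendsto_nhdsWithin_iff.2 ⟨Complex.continuous_ofReal.continuousWithinAt,
        eventually_nhdsWithin_of_forall fun r (hr : 1 < r) => by simpa using hr.ne'⟩
    refine hmap.frequently (Eventually.frequently (f := 𝓝[>] (1 : ℝ)) ?_)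
    exact eventually_nhdsWithin_of_forall fun r (hr : 1 < r) => heq_real r (one_pos.trans hr)
  exact (analyticOnNhd_laplace_rpow (by linarith)).eqOn_of_preconnected_of_frequently_eq hpow
    (convex_halfSpace_re_gt 0).isPreconnected (by simp) hfreq hz

/-- The exponentially damped causal Riesz kernel `t ↦ t ^ (β - 1) exp (-ε t) / Γ(β)`, `t > 0`;
as `ε → 0` it approximates the kernel of the left fractional integral. -/
def dampedKernel (β ε : ℝ) : ℝ → ℝ :=
  (Ioi (0 : ℝ)).indicator fun t => t ^ (β - 1) * exp (-(ε * t)) / Gamma β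

/-- The damped angular frequency `ε + i ω`, where `ω = 2 π ξ`; `dampedFreq ε ξ ^ (-β)` is the
Fourier symbol of `dampedKernel β ε`. -/
def dampedFreq (ε ξ : ℝ) : ℂ := ε + 2 * π * Complex.I * ξ

@[simp]
theorem re_dampedFreq (ε ξ : ℝ) : (dampedFreq ε ξ).re = ε := by simp [dampedFreq]

@[simp]
theorem im_dampedFreq (ε ξ : ℝ) : (dampedFreq ε ξ).im = 2 * π * ξ := by simp [dampedFreq]

theorem dampedFreq_ne_zero {ε : ℝ} (hε : ε ≠ 0) (ξ : ℝ) : dampedFreq ε ξ ≠ 0 := by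
  intro h
  simpa [hε] using congrArg Complex.re h

@[fun_prop]
theorem continuous_dampedFreq (ε : ℝ) : Continuous (dampedFreq ε) := by
  unfold dampedFreq
  fun_prop

theorem integrable_dampedKernel {β ε : ℝ} (hβ : 0 < β) (hε : 0 < ε) :
    Integrable (dampedKernel β ε) := by
  rw [dampedKernel, integrable_indicator_iff measurableSet_Ioi]
  exact (integrableOn_rpow_mul_exp_neg_mul (by linarith) hε).div_const _

/-- Convolution of real functions on the line. -/
abbrev conv (K f : ℝ → ℝ) : ℝ → ℝ := convolution K f (ContinuousLinearMap.mul ℝ ℝ) volume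

theorem conv_apply (K f : ℝ → ℝ) (x : ℝ) : conv K f x = ∫ t, K t * f (x - t) := rfl

theorem conv_apply_swap (K f : ℝ → ℝ) (x : ℝ) : conv K f x = ∫ s, K (x - s) * f s :=
  convolution_mul_swap

/-- The Fourier transform of a real function, in the frequency `ξ = ω / (2 π)`. -/
abbrev fhat (f : ℝ → ℝ) : ℝ → ℂ := 𝓕 (fun x => (f x : ℂ))

theorem norm_fhat_le (f : ℝ → ℝ) (ξ : ℝ) : ‖fhat f ξ‖ ≤ ∫ x, |f x| := by
  refine (VectorFourier.norm_fourierIntegral_le_integral_norm _ _ _ _ ξ).trans_eq ?_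
  simp only [Complex.norm_real, norm_eq_abs]

theorem continuous_fhat {f : ℝ → ℝ} (hf : Integrable f) : Continuous (fhat f) :=
  VectorFourier.fourierIntegral_continuous Real.continuous_fourierChar continuous_inner hf.ofReal

theorem fhat_conv {K f : ℝ → ℝ} (hK : Integrable K) (hf : Integrable f) (ξ : ℝ) :
    fhat (conv K f) ξ = fhat K ξ * fhat f ξ := by
  have h : (fun x => (conv K f x : ℂ)) = convolution (fun x => (K x : ℂ)) (fun x => (f x : ℂ))
      (ContinuousLinearMap.mul ℂ ℂ) volume := by
    funext x
    rw [conv_apply, ← integral_complex_ofReal, convolution_mul]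
    simp
  rw [fhat, h]
  exact Real.fourier_mul_convolution_eq hK.ofReal hf.ofReal ξ

theorem fhat_comp_neg (f : ℝ → ℝ) (ξ : ℝ) :
    fhat (fun t => f (-t)) ξ = (starRingEnd ℂ) (fhat f ξ) := by
  simp only [fhat, Real.fourier_real_eq_integral_exp_smul]
  rw [← integral_conj, ← integral_neg_eq_self (fun t => (starRingEnd ℂ) _)]
  refine integral_congr_ae (Eventually.of_forall fun t => ?_)
  simp only [smul_eq_mul, map_mul, Complex.conj_ofReal, ← Complex.exp_conj, Complex.conj_I]
  congr 2
  push_cast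
  ring

theorem fhat_dampedKernel {β ε : ℝ} (hβ : 0 < β) (hε : 0 < ε) (ξ : ℝ) :
    fhat (dampedKernel β ε) ξ = dampedFreq ε ξ ^ (-β : ℂ) := by
  have hΓ : (Gamma β : ℂ) ≠ 0 := Complex.ofReal_ne_zero.2 (Gamma_pos_of_pos hβ).ne'
  rw [fhat, Real.fourier_real_eq_integral_exp_smul, ← mul_right_inj' hΓ,
    ← integral_rpow_mul_cexp_neg_mul_Ioi hβ (by simpa using hε : 0 < (dampedFreq ε ξ).re),
    ← integral_const_mul, ← integral_indicator measurableSet_Ioi]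
  refine integral_congr_ae (Eventually.of_forall fun t => ?_)
  by_cases ht : t ∈ Ioi (0 : ℝ)
  · have hexp : -(dampedFreq ε ξ * t) = -(ε * t) + ((-2 * π * t * ξ : ℝ) : ℂ) * Complex.I := by
      rw [dampedFreq]; push_cast; ring
    simp only [dampedKernel, indicator_of_mem ht, smul_eq_mul, hexp, Complex.exp_add]
    push_cast
    field_simp
  · simp [dampedKernel, indicator_of_notMem ht]

theorem integral_conj_mul_eq_fourier {u v : ℝ → ℂ} (hu : Integrable u) (hv : Integrable v)
    (hvc : Continuous v) (hv' : Integrable (𝓕 v)) :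
    ∫ x, (starRingEnd ℂ) (u x) * v x = ∫ ξ, (starRingEnd ℂ) (𝓕 u ξ) * 𝓕 v ξ := by
  have h := VectorFourier.integral_sesq_fourierIntegral_eq_neg_flip (innerSL ℂ (E := ℂ))
    (L := innerₗ ℝ) (μ := volume) (ν := volume) Real.continuous_fourierChar continuous_inner hu hv'
  have hinv : ∀ x, VectorFourier.fourierIntegral 𝐞 volume (-(innerₗ ℝ).flip) (𝓕 v) x = v x := by
    intro x
    rw [← congrFun (hvc.fourierInv_fourier_eq hv hv') x]
    simp [Real.fourierInv_eq, VectorFourier.fourierIntegral]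
  simp only [hinv, innerSL_apply_apply, RCLike.inner_apply] at h
  simp only [mul_comm ((starRingEnd ℂ) _)]
  exact h.symm

theorem integral_mul_eq_fhat {u v : ℝ → ℝ} (hu : Integrable u) (hv : Integrable v)
    (hvc : Continuous v) (hv' : Integrable (fhat v)) :
    ∫ x, u x * v x = ∫ ξ, ((starRingEnd ℂ) (fhat u ξ) * fhat v ξ).re := by
  have hint : Integrable fun ξ => (starRingEnd ℂ) (fhat u ξ) * fhat v ξ :=
    hv'.bdd_mul (continuous_fhat hu).star.aestronglyMeasurable
      (Eventually.of_forall fun ξ => by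
        rw [starRingEnd_apply, norm_star]; exact norm_fhat_le u ξ)
  have hre : ∫ ξ, ((starRingEnd ℂ) (fhat u ξ) * fhat v ξ).re =
      (∫ ξ, (starRingEnd ℂ) (fhat u ξ) * fhat v ξ).re := Complex.reCLM.integral_comp_comm hint
  have hcast : ∫ x, (starRingEnd ℂ) (u x : ℂ) * (v x : ℂ) = ((∫ x, u x * v x : ℝ) : ℂ) := by
    rw [← integral_complex_ofReal]
    simp
  rw [hre, ← Complex.ofReal_re (∫ x, u x * v x), ← hcast]
  exact congrArg Complex.re (integral_conj_mul_eq_fourier hu.ofReal hv.ofReal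
    (Complex.continuous_ofReal.comp hvc) hv')

namespace IsTestFunction

variable {φ : ℝ → ℝ}

theorem continuous (hφ : IsTestFunction φ) : Continuous φ := hφ.smooth.continuous

theorem differentiable (hφ : IsTestFunction φ) : Differentiable ℝ φ :=
  hφ.smooth.differentiable (by simp)

theorem deriv (hφ : IsTestFunction φ) : IsTestFunction (deriv φ) where
  smooth := (contDiff_infty_iff_deriv.1 hφ.smooth).2
  hasCompactSupport := hφ.hasCompactSupport.deriv
  tsupport_subset := (tsupport_deriv_subset (𝕜 := ℝ)).trans hφ.tsupport_subset

theorem integrable (hφ : IsTestFunction φ) : Integrable φ :=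
  hφ.continuous.integrable_of_hasCompactSupport hφ.hasCompactSupport

theorem memLp_two (hφ : IsTestFunction φ) : MemLp φ 2 volume :=
  hφ.continuous.memLp_of_hasCompactSupport hφ.hasCompactSupport

theorem eq_zero (hφ : IsTestFunction φ) {x : ℝ} (hx : x ∉ Ioo (0 : ℝ) 1) : φ x = 0 :=
  image_eq_zero_of_notMem_tsupport fun h => hx (hφ.tsupport_subset h)

/-- A test function as a complex Schwartz function. -/
def schwartz (hφ : IsTestFunction φ) : SchwartzMap ℝ ℂ :=
  HasCompactSupport.toSchwartzMap (f := fun x => (φ x : ℂ))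
    (hφ.hasCompactSupport.comp_left (g := Complex.ofReal) Complex.ofReal_zero)
    (Complex.ofRealCLM.contDiff.comp hφ.smooth)

theorem fourier_schwartz (hφ : IsTestFunction φ) :
    ((𝓕 hφ.schwartz : SchwartzMap ℝ ℂ) : ℝ → ℂ) = fhat φ := rfl

theorem integrable_fhat (hφ : IsTestFunction φ) : Integrable (fhat φ) := by
  rw [← hφ.fourier_schwartz]; exact SchwartzMap.integrable _

theorem fhat_deriv (hφ : IsTestFunction φ) (ξ : ℝ) :
    fhat (_root_.deriv φ) ξ = (2 * π * Complex.I * ξ) * fhat φ ξ := by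
  have hd (x : ℝ) : HasDerivAt (fun x => (φ x : ℂ)) ((_root_.deriv φ x : ℝ) : ℂ) x :=
    (hφ.differentiable x).hasDerivAt.ofReal_comp
  have hderiv : _root_.deriv (fun x => (φ x : ℂ)) = fun x => ((_root_.deriv φ x : ℝ) : ℂ) :=
    deriv_eq hd
  have h := Real.fourier_deriv hφ.integrable.ofReal (fun x => (hd x).differentiableAt)
    (by rw [hderiv]; exact hφ.deriv.integrable.ofReal)
  rw [hderiv] at h
  exact congrFun h ξ

theorem norm_fhat_deriv_sq (hφ : IsTestFunction φ) (ξ : ℝ) :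
    ‖fhat (_root_.deriv φ) ξ‖ ^ 2 = |2 * π * ξ| ^ 2 * ‖fhat φ ξ‖ ^ 2 := by
  rw [hφ.fhat_deriv, norm_mul, mul_pow]
  simp [abs_of_pos pi_pos]

end IsTestFunction

/-- The square of the seminorm `‖|ω| ^ μ 𝓕 φ‖` of `H^μ(ℝ)`. -/
def seminormSq (μ : ℝ) (φ : ℝ → ℝ) : ℝ :=
  ∫ ξ, |2 * π * ξ| ^ (2 * μ) * ‖fhat φ ξ‖ ^ 2

theorem abs_rpow_le_one_add_abs_rpow {s t : ℝ} (hs : 0 ≤ s) (hst : s ≤ t) (y : ℝ) :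
    |y| ^ s ≤ 1 + |y| ^ t := by
  rcases le_total |y| 1 with h | h
  · exact (rpow_le_one (abs_nonneg y) h hs).trans (le_add_of_nonneg_right (by positivity))
  · exact (rpow_le_rpow_of_exponent_le h hst).trans (le_add_of_nonneg_left zero_le_one)

namespace IsTestFunction

variable {φ : ℝ → ℝ}

theorem integrable_pow_mul_norm_fhat_sq (hφ : IsTestFunction φ) (n : ℕ) :
    Integrable fun ξ : ℝ => |2 * π * ξ| ^ n * ‖fhat φ ξ‖ ^ 2 := by
  have h := ((𝓕 hφ.schwartz : SchwartzMap ℝ ℂ).integrable_pow_mul volume n).const_mul ((2 * π) ^ n)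
  rw [hφ.fourier_schwartz] at h
  refine (h.mul_bdd (continuous_fhat hφ.integrable).norm.aestronglyMeasurable
    (Eventually.of_forall fun ξ => (norm_norm _).trans_le (norm_fhat_le φ ξ))).congr
    (Eventually.of_forall fun ξ => ?_)
  simp only [abs_mul, abs_of_pos pi_pos, abs_two, Real.norm_eq_abs]
  ring

theorem integrable_norm_fhat_sq (hφ : IsTestFunction φ) :
    Integrable fun ξ : ℝ => ‖fhat φ ξ‖ ^ 2 := by
  simpa using hφ.integrable_pow_mul_norm_fhat_sq 0

theorem integrable_rpow_mul_norm_fhat_sq (hφ : IsTestFunction φ) {s : ℝ} (hs : 0 ≤ s) :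
    Integrable fun ξ : ℝ => |2 * π * ξ| ^ s * ‖fhat φ ξ‖ ^ 2 := by
  obtain ⟨n, hn⟩ := exists_nat_ge s
  refine (hφ.integrable_norm_fhat_sq.add (hφ.integrable_pow_mul_norm_fhat_sq n)).mono' ?_
    (Eventually.of_forall fun ξ => ?_)
  · refine Continuous.aestronglyMeasurable
      (Continuous.mul ?_ ((continuous_fhat hφ.integrable).norm.pow 2))
    exact Continuous.rpow_const (by fun_prop) fun _ => Or.inr hs
  · rw [Real.norm_of_nonneg (by positivity), Pi.add_apply, ← one_add_mul, ← rpow_natCast _ n]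
    exact mul_le_mul_of_nonneg_right (abs_rpow_le_one_add_abs_rpow hs hn _) (by positivity)

theorem integral_sq_eq_fhat (hφ : IsTestFunction φ) :
    ∫ x, φ x ^ 2 = ∫ ξ, ‖fhat φ ξ‖ ^ 2 := by
  have h := integral_mul_eq_fhat hφ.integrable hφ.integrable hφ.continuous hφ.integrable_fhat
  simp only [Complex.conj_mul', ← Complex.ofReal_pow, Complex.ofReal_re, ← sq] at h
  exact h

theorem setIntegral_eq (hφ : IsTestFunction φ) {g : ℝ → ℝ} (hg : ∀ x, φ x = 0 → g x = 0) :
    ∫ x in Ioo (0 : ℝ) 1, g x = ∫ x, g x :=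
  setIntegral_eq_integral_of_forall_compl_eq_zero fun x hx => hg x (hφ.eq_zero hx)

theorem sq_integral_abs_le (hφ : IsTestFunction φ) : (∫ x, |φ x|) ^ 2 ≤ ∫ x, φ x ^ 2 := by
  have : IsProbabilityMeasure (volume.restrict (Ioo (0 : ℝ) 1)) := ⟨by simp⟩
  have hjensen := (even_two.convexOn_pow (𝕜 := ℝ)).map_integral_le
    (μ := volume.restrict (Ioo (0 : ℝ) 1)) (f := fun x => |φ x|) (by fun_prop) isClosed_univ
    (Eventually.of_forall fun _ => mem_univ _) hφ.integrable.abs.integrableOn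
    (by simpa [Function.comp_def] using hφ.memLp_two.integrable_sq.restrict)
  simp only [sq_abs] at hjensen
  rwa [hφ.setIntegral_eq (by simp), hφ.setIntegral_eq (by simp)] at hjensen

theorem norm_fhat_sq_le (hφ : IsTestFunction φ) {μ : ℝ} (hμ : 0 ≤ μ) (ξ : ℝ) :
    ‖fhat φ ξ‖ ^ 2 ≤ (Ioo (-(1 / 4) : ℝ) (1 / 4)).indicator (fun _ => ∫ x, φ x ^ 2) ξ +
      |2 * π * ξ| ^ (2 * μ) * ‖fhat φ ξ‖ ^ 2 := by
  by_cases hξ : ξ ∈ Ioo (-(1 / 4) : ℝ) (1 / 4)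
  · rw [indicator_of_mem hξ]
    have hlow : ‖fhat φ ξ‖ ^ 2 ≤ ∫ x, φ x ^ 2 :=
      (pow_le_pow_left₀ (norm_nonneg _) (norm_fhat_le φ ξ) 2).trans hφ.sq_integral_abs_le
    exact hlow.trans (le_add_of_nonneg_right (by positivity))
  · rw [indicator_of_notMem hξ, zero_add]
    have hξ' : 1 / 4 ≤ |ξ| := by
      by_contra! hc
      exact hξ (abs_lt.1 hc)
    have hω : 1 ≤ |2 * π * ξ| := by
      rw [abs_mul, abs_of_pos (by positivity : (0 : ℝ) < 2 * π)]
      nlinarith [pi_gt_three]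
    exact le_mul_of_one_le_left (by positivity) (one_le_rpow hω (by linarith))

-- The spectrum of a function on the unit interval is bounded by its `L²` norm, so the
-- frequencies `|ξ| < 1/4` carry at most half of its mass.
theorem integral_sq_le_seminormSq (hφ : IsTestFunction φ) {μ : ℝ} (hμ : 0 ≤ μ) :
    ∫ x, φ x ^ 2 ≤ 2 * seminormSq μ φ := by
  have hind : Integrable ((Ioo (-(1 / 4) : ℝ) (1 / 4)).indicator fun _ => ∫ x, φ x ^ 2) :=
    (integrable_indicator_iff measurableSet_Ioo).2 (by simp)
  have hsemi := hφ.integrable_rpow_mul_norm_fhat_sq (s := 2 * μ) (by linarith)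
  have h := integral_mono hφ.integrable_norm_fhat_sq (hind.add hsemi) (hφ.norm_fhat_sq_le hμ)
  rw [← hφ.integral_sq_eq_fhat, integral_add' hind hsemi, integral_indicator measurableSet_Ioo,
    setIntegral_const, Real.volume_real_Ioo_of_le (by norm_num), smul_eq_mul] at h
  rw [seminormSq]
  linarith

theorem exists_abs_le (hφ : IsTestFunction φ) : ∃ B, ∀ x, |φ x| ≤ B :=
  hφ.hasCompactSupport.exists_bound_of_continuous hφ.continuous

theorem reflect (hφ : IsTestFunction φ) : IsTestFunction fun x => φ (1 - x) where
  smooth := hφ.smooth.comp (contDiff_const.sub contDiff_id)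
  hasCompactSupport := hφ.hasCompactSupport.comp_homeomorph (Homeomorph.subLeft 1)
  tsupport_subset := by
    have h : tsupport (fun x => φ (1 - x)) = (Homeomorph.subLeft (1 : ℝ)) ⁻¹' tsupport φ :=
      tsupport_comp_eq_preimage φ (Homeomorph.subLeft (1 : ℝ))
    rw [h]
    refine (preimage_mono hφ.tsupport_subset).trans_eq ?_
    simp

end IsTestFunction

section Convolution

variable {K L φ : ℝ → ℝ}

theorem integrable_conv {f : ℝ → ℝ} (hK : Integrable K) (hf : Integrable f) :
    Integrable (conv K f) := hK.integrable_convolution _ hf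

theorem continuous_conv (hK : Integrable K) (hφ : IsTestFunction φ) : Continuous (conv K φ) :=
  hφ.hasCompactSupport.continuous_convolution_right _ hK.locallyIntegrable hφ.continuous

theorem integrable_mul_comp_sub (hK : Integrable K) (hφ : IsTestFunction φ) (x : ℝ) :
    Integrable fun t => K t * φ (x - t) := by
  obtain ⟨B, hB⟩ := hφ.exists_abs_le
  exact hK.mul_bdd (hφ.continuous.comp (continuous_const.sub continuous_id)).aestronglyMeasurable
    (Eventually.of_forall fun t => hB (x - t))

theorem abs_conv_le (hK : Integrable K) {f : ℝ → ℝ} {B : ℝ} (hB : ∀ x, |f x| ≤ B) (x : ℝ) :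
    |conv K f x| ≤ (∫ t, |K t|) * B := by
  rw [conv_apply, ← Real.norm_eq_abs, ← integral_mul_const]
  refine norm_integral_le_of_norm_le (hK.abs.mul_const B) (Eventually.of_forall fun t => ?_)
  rw [norm_mul]
  exact mul_le_mul_of_nonneg_left (hB _) (norm_nonneg _)

theorem integrable_conv_sq (hK : Integrable K) (hφ : IsTestFunction φ) :
    Integrable fun x => conv K φ x ^ 2 := by
  obtain ⟨B, hB⟩ := hφ.exists_abs_le
  simp only [sq]
  exact (integrable_conv hK hφ.integrable).mul_bdd (continuous_conv hK hφ).aestronglyMeasurable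
    (Eventually.of_forall (abs_conv_le hK hB))

theorem integrable_fhat_conv (hK : Integrable K) (hφ : IsTestFunction φ) :
    Integrable (fhat (conv K φ)) := by
  rw [show fhat (conv K φ) = fun ξ => fhat K ξ * fhat φ ξ from funext (fhat_conv hK hφ.integrable)]
  exact hφ.integrable_fhat.bdd_mul (continuous_fhat hK).aestronglyMeasurable
    (Eventually.of_forall (norm_fhat_le K))

theorem integral_conv_mul_conv (hK : Integrable K) (hL : Integrable L) (hφ : IsTestFunction φ) :
    ∫ x, conv K φ x * conv L φ x =
      ∫ ξ, ((starRingEnd ℂ) (fhat K ξ) * fhat L ξ).re * ‖fhat φ ξ‖ ^ 2 := by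
  rw [integral_mul_eq_fhat (integrable_conv hK hφ.integrable) (integrable_conv hL hφ.integrable)
    (continuous_conv hL hφ) (integrable_fhat_conv hL hφ)]
  refine integral_congr_ae (Eventually.of_forall fun ξ => ?_)
  simp only [fhat_conv hK hφ.integrable, fhat_conv hL hφ.integrable]
  rw [map_mul, mul_mul_mul_comm, Complex.conj_mul', ← Complex.ofReal_pow, Complex.re_mul_ofReal]

theorem integral_mul_conv (hK : Integrable K) (hφ : IsTestFunction φ) :
    ∫ x, φ x * conv K φ x = ∫ ξ, (fhat K ξ).re * ‖fhat φ ξ‖ ^ 2 := by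
  rw [integral_mul_eq_fhat hφ.integrable (integrable_conv hK hφ.integrable)
    (continuous_conv hK hφ) (integrable_fhat_conv hK hφ)]
  refine integral_congr_ae (Eventually.of_forall fun ξ => ?_)
  simp only [fhat_conv hK hφ.integrable]
  rw [mul_left_comm, Complex.conj_mul', ← Complex.ofReal_pow, Complex.re_mul_ofReal]

/-- The reflection of a function on the line; it exchanges left and right fractional integrals. -/
abbrev refl (K : ℝ → ℝ) : ℝ → ℝ := fun t => K (-t)

theorem integrable_refl (hK : Integrable K) : Integrable (refl K) := hK.comp_neg

theorem conv_refl (K f : ℝ → ℝ) (x : ℝ) :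
    conv (refl K) f x = conv K (fun y => f (1 - y)) (1 - x) := by
  rw [conv_apply, conv_apply, ← integral_neg_eq_self]
  refine integral_congr_ae (Eventually.of_forall fun t => ?_)
  simp only [refl, neg_neg]
  congr 2
  ring

end Convolution

/-- The kernel `t ↦ t ^ (β - 1) / Γ(β)` of the left fractional integral, cut off to the unit
interval so that it is integrable; on `(0,1)` the cutoff does not affect convolutions with
functions supported in `(0,1)`. -/
def intervalKernel (β : ℝ) : ℝ → ℝ :=
  (Ioo (0 : ℝ) 1).indicator fun t => t ^ (β - 1) / Gamma β

theorem integrable_intervalKernel {β : ℝ} (hβ : 0 < β) : Integrable (intervalKernel β) := by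
  rw [intervalKernel, integrable_indicator_iff measurableSet_Ioo]
  exact ((intervalIntegral.integrableOn_Ioo_rpow_iff one_pos).2 (by linarith)).div_const _

/-- Almost everywhere convergence `f i → F` along `l` of uniformly bounded functions: what the
bounded convergence theorem asks for. -/
structure TendstoBoundedly {α ι : Type*} [MeasurableSpace α] (f : ι → α → ℝ) (l : Filter ι)
    (F : α → ℝ) (ν : Measure α) : Prop where
  aestronglyMeasurable : ∀ᶠ i in l, AEStronglyMeasurable (f i) ν
  exists_bound : ∃ B, ∀ᶠ i in l, ∀ᵐ x ∂ν, |f i x| ≤ B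
  tendsto : ∀ᵐ x ∂ν, Tendsto (fun i => f i x) l (𝓝 (F x))

namespace TendstoBoundedly

variable {α ι : Type*} [MeasurableSpace α] {f g : ι → α → ℝ} {l : Filter ι} {F G : α → ℝ}
  {ν : Measure α}

theorem integral_mul [IsFiniteMeasure ν] [l.IsCountablyGenerated] (hf : TendstoBoundedly f l F ν)
    (hg : TendstoBoundedly g l G ν) :
    Tendsto (fun i => ∫ x, f i x * g i x ∂ν) l (𝓝 (∫ x, F x * G x ∂ν)) := by
  obtain ⟨B, hB⟩ := hf.exists_bound
  obtain ⟨C, hC⟩ := hg.exists_bound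
  refine tendsto_integral_filter_of_dominated_convergence (fun _ => B * C) ?_ ?_
    (integrable_const _) ?_
  · filter_upwards [hf.aestronglyMeasurable, hg.aestronglyMeasurable] with i hfi hgi
    exact hfi.mul hgi
  · filter_upwards [hB, hC] with i hfi hgi
    filter_upwards [hfi, hgi] with x hfx hgx
    rw [norm_mul]
    exact mul_le_mul hfx hgx (norm_nonneg _) ((abs_nonneg _).trans hfx)
  · filter_upwards [hf.tendsto, hg.tendsto] with x hfx hgx
    exact hfx.mul hgx

theorem comp_measurePreserving {β : Type*} [MeasurableSpace β] {ρ : Measure β} {T : β → α}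
    (hf : TendstoBoundedly f l F ν) (hT : MeasurePreserving T ρ ν) :
    TendstoBoundedly (fun i x => f i (T x)) l (fun x => F (T x)) ρ where
  aestronglyMeasurable := hf.aestronglyMeasurable.mono fun _ h => h.comp_measurePreserving hT
  exists_bound := hf.exists_bound.imp fun _ h =>
    h.mono fun _ h' => hT.quasiMeasurePreserving.ae h'
  tendsto := hT.quasiMeasurePreserving.ae hf.tendsto

end TendstoBoundedly

theorem IsTestFunction.tendstoBoundedly_const {ι : Type*} {l : Filter ι} {φ : ℝ → ℝ}
    {ν : Measure ℝ} (hφ : IsTestFunction φ) : TendstoBoundedly (fun _ : ι => φ) l φ ν where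
  aestronglyMeasurable := Eventually.of_forall fun _ => hφ.continuous.aestronglyMeasurable
  exists_bound := hφ.exists_abs_le.imp fun _ hB =>
    Eventually.of_forall fun _ => Eventually.of_forall hB
  tendsto := Eventually.of_forall fun _ => tendsto_const_nhds

section DampedConvolution

variable {β ε x : ℝ} {φ : ℝ → ℝ}

theorem dampedKernel_mul_comp_sub (hφ : IsTestFunction φ) (hx : x < 1) (t : ℝ) :
    dampedKernel β ε t * φ (x - t) = exp (-(ε * t)) * (intervalKernel β t * φ (x - t)) := by
  rcases eq_or_ne (φ (x - t)) 0 with h | h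
  · simp [h]
  have hxt : x - t ∈ Ioo (0 : ℝ) 1 := by
    by_contra hc
    exact h (hφ.eq_zero hc)
  by_cases ht : 0 < t
  · rw [dampedKernel, intervalKernel, indicator_of_mem (mem_Ioi.2 ht),
      indicator_of_mem (by constructor <;> linarith [hxt.1])]
    ring
  · rw [dampedKernel, intervalKernel, indicator_of_notMem (by simpa using ht),
      indicator_of_notMem (by simp [ht])]
    simp

theorem abs_exp_mul_intervalKernel_mul_le (hε : 0 ≤ ε) (t c : ℝ) :
    |exp (-(ε * t)) * (intervalKernel β t * c)| ≤ |intervalKernel β t * c| := by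
  by_cases ht : t ∈ Ioo (0 : ℝ) 1
  · rw [abs_mul, abs_of_nonneg (exp_nonneg _)]
    exact mul_le_of_le_one_left (abs_nonneg _)
      (exp_le_one_iff.2 (neg_nonpos.2 (mul_nonneg hε ht.1.le)))
  · simp [intervalKernel, indicator_of_notMem ht]

theorem tendsto_conv_dampedKernel (hβ : 0 < β) (hφ : IsTestFunction φ) (hx : x < 1) :
    Tendsto (fun ε => conv (dampedKernel β ε) φ x) (𝓝[>] 0)
      (𝓝 (conv (intervalKernel β) φ x)) := by
  have hint := integrable_mul_comp_sub (integrable_intervalKernel hβ) hφ x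
  simp only [conv_apply, dampedKernel_mul_comp_sub hφ hx]
  refine tendsto_integral_filter_of_dominated_convergence
    (fun t => |intervalKernel β t * φ (x - t)|) ?_ ?_ hint.abs ?_
  · exact Eventually.of_forall fun ε =>
      (Continuous.aestronglyMeasurable (by fun_prop)).mul hint.aestronglyMeasurable
  · filter_upwards [self_mem_nhdsWithin] with ε hε
    exact Eventually.of_forall fun t => abs_exp_mul_intervalKernel_mul_le (le_of_lt hε) t _
  · refine Eventually.of_forall fun t => ?_
    have hcont : Continuous fun ε : ℝ => exp (-(ε * t)) * (intervalKernel β t * φ (x - t)) := by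
      fun_prop
    simpa using (hcont.tendsto 0).mono_left nhdsWithin_le_nhds

theorem abs_conv_dampedKernel_le (hβ : 0 < β) (hε : 0 ≤ ε) (hφ : IsTestFunction φ) {B : ℝ}
    (hB : ∀ x, |φ x| ≤ B) (hx : x < 1) :
    |conv (dampedKernel β ε) φ x| ≤ (∫ t, |intervalKernel β t|) * B := by
  simp only [conv_apply, dampedKernel_mul_comp_sub hφ hx]
  rw [← Real.norm_eq_abs, ← integral_mul_const]
  refine norm_integral_le_of_norm_le ((integrable_intervalKernel hβ).abs.mul_const B)
    (Eventually.of_forall fun t => (abs_exp_mul_intervalKernel_mul_le hε t _).trans ?_)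
  rw [abs_mul]
  exact mul_le_mul_of_nonneg_left (hB _) (abs_nonneg _)

theorem tendstoBoundedly_conv_dampedKernel (hβ : 0 < β) (hφ : IsTestFunction φ) :
    TendstoBoundedly (fun ε => conv (dampedKernel β ε) φ) (𝓝[>] 0) (conv (intervalKernel β) φ)
      (volume.restrict (Ioo 0 1)) where
  aestronglyMeasurable := eventually_nhdsWithin_of_forall fun ε hε =>
    (continuous_conv (integrable_dampedKernel hβ hε) hφ).aestronglyMeasurable
  exists_bound := by
    obtain ⟨B, hB⟩ := hφ.exists_abs_le
    exact ⟨_, eventually_nhdsWithin_of_forall fun ε (hε : 0 < ε) =>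
      (ae_restrict_mem measurableSet_Ioo).mono fun x hx =>
        abs_conv_dampedKernel_le hβ hε.le hφ hB hx.2⟩
  tendsto := (ae_restrict_mem measurableSet_Ioo).mono fun x hx =>
    tendsto_conv_dampedKernel hβ hφ hx.2

theorem measurePreserving_one_sub_Ioo :
    MeasurePreserving (fun x : ℝ => 1 - x) (volume.restrict (Ioo 0 1))
      (volume.restrict (Ioo 0 1)) := by
  simpa using (Measure.measurePreserving_sub_left volume (1 : ℝ)).restrict_preimage
    (measurableSet_Ioo (a := (0 : ℝ)) (b := 1))

theorem tendstoBoundedly_conv_refl_dampedKernel (hβ : 0 < β) (hφ : IsTestFunction φ) :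
    TendstoBoundedly (fun ε => conv (refl (dampedKernel β ε)) φ) (𝓝[>] 0)
      (conv (refl (intervalKernel β)) φ) (volume.restrict (Ioo 0 1)) := by
  have h := (tendstoBoundedly_conv_dampedKernel hβ hφ.reflect).comp_measurePreserving
    measurePreserving_one_sub_Ioo
  simpa only [← conv_refl] using h

theorem conv_dampedKernel_eq_zero (hφ : IsTestFunction φ) (hx : x ≤ 0) :
    conv (dampedKernel β ε) φ x = 0 := by
  rw [conv_apply]
  refine integral_eq_zero_of_ae (Eventually.of_forall fun t => ?_)
  by_cases ht : 0 < t
  · simp [hφ.eq_zero (x := x - t) fun h => by linarith [h.1]]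
  · simp [dampedKernel, indicator_of_notMem (s := Ioi (0 : ℝ)) (a := t) (by simpa using ht)]

theorem conv_refl_dampedKernel_eq_zero (hφ : IsTestFunction φ) (hx : 1 ≤ x) :
    conv (refl (dampedKernel β ε)) φ x = 0 := by
  rw [conv_refl]
  exact conv_dampedKernel_eq_zero hφ.reflect (by linarith)

end DampedConvolution

theorem cos_mul_norm_rpow_le_re_cpow {z : ℂ} (hz : z ≠ 0) (hre : 0 ≤ z.re) {s : ℝ} (hs : 0 ≤ s)
    (hs2 : s ≤ 2) : cos (π * s / 2) * ‖z‖ ^ (-s) ≤ (z ^ (-s : ℂ)).re := by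
  have harg : |z.arg| ≤ π / 2 := Complex.abs_arg_le_pi_div_two_iff.2 hre
  have hpolar : z ^ (-s : ℂ) =
      ((‖z‖ ^ (-s) : ℝ) : ℂ) * Complex.exp ((-(s * z.arg) : ℝ) * Complex.I) := by
    rw [Complex.cpow_def_of_ne_zero hz, Complex.log, rpow_def_of_pos (norm_pos_iff.2 hz),
      Complex.ofReal_exp, ← Complex.exp_add]
    congr 1
    push_cast
    ring
  rw [hpolar, Complex.re_ofReal_mul, Complex.exp_ofReal_mul_I_re, mul_comm, cos_neg,
    ← cos_abs (s * _), abs_mul, abs_of_nonneg hs]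
  gcongr
  apply cos_le_cos_of_nonneg_of_le_pi (by positivity)
  · nlinarith [pi_pos]
  · nlinarith

theorem abs_le_norm_dampedFreq (ε ξ : ℝ) : |2 * π * ξ| ≤ ‖dampedFreq ε ξ‖ := by
  simpa only [im_dampedFreq] using Complex.abs_im_le_norm (dampedFreq ε ξ)

theorem continuous_norm_dampedFreq_rpow {ε : ℝ} (hε : ε ≠ 0) (s : ℝ) :
    Continuous fun ξ => ‖dampedFreq ε ξ‖ ^ s :=
  (continuous_dampedFreq ε).norm.rpow_const fun ξ =>
    Or.inl (norm_ne_zero_iff.2 (dampedFreq_ne_zero hε ξ))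

theorem rpow_neg_mul_sq {y : ℝ} (hy : 0 < y) (s : ℝ) : y ^ (-s) * y ^ 2 = y ^ (2 - s) := by
  rw [← rpow_two, ← rpow_add hy, neg_add_eq_sub]

theorem norm_dampedFreq_rpow_mul_sq_le {s : ℝ} (hs : 0 ≤ s) (ε ξ : ℝ) :
    ‖dampedFreq ε ξ‖ ^ (-s) * |2 * π * ξ| ^ 2 ≤ |2 * π * ξ| ^ (2 - s) := by
  rcases (abs_nonneg (2 * π * ξ)).eq_or_lt with h | h
  · rw [← h, zero_pow two_ne_zero, mul_zero]
    exact rpow_nonneg le_rfl _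
  · rw [← rpow_neg_mul_sq h]
    gcongr ?_ * _
    exact rpow_le_rpow_of_nonpos h (abs_le_norm_dampedFreq ε ξ) (neg_nonpos.2 hs)

/-- The energy of `deriv φ` weighted with `|ε + i ω| ^ (-s)`; it increases to
`seminormSq (1 - s / 2) φ` as `ε → 0`. -/
def dampedEnergy (ε s : ℝ) (φ : ℝ → ℝ) : ℝ :=
  ∫ ξ, ‖dampedFreq ε ξ‖ ^ (-s) * ‖fhat (deriv φ) ξ‖ ^ 2

section Energy

variable {φ : ℝ → ℝ} {ε s : ℝ}

theorem dampedEnergy_integrand_le (hφ : IsTestFunction φ) (hs : 0 ≤ s) (ε ξ : ℝ) :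
    ‖dampedFreq ε ξ‖ ^ (-s) * ‖fhat (deriv φ) ξ‖ ^ 2 ≤
      |2 * π * ξ| ^ (2 * (1 - s / 2)) * ‖fhat φ ξ‖ ^ 2 := by
  rw [hφ.norm_fhat_deriv_sq, ← mul_assoc, show 2 * (1 - s / 2) = 2 - s by ring]
  exact mul_le_mul_of_nonneg_right (norm_dampedFreq_rpow_mul_sq_le hs ε ξ) (by positivity)

theorem continuous_dampedEnergy_integrand (hφ : IsTestFunction φ) (hε : ε ≠ 0) (s : ℝ) :
    Continuous fun ξ => ‖dampedFreq ε ξ‖ ^ (-s) * ‖fhat (deriv φ) ξ‖ ^ 2 :=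
  (continuous_norm_dampedFreq_rpow hε _).mul ((continuous_fhat hφ.deriv.integrable).norm.pow 2)

theorem integrable_dampedEnergy_integrand (hφ : IsTestFunction φ) (hε : ε ≠ 0) (hs : 0 ≤ s)
    (hs2 : s ≤ 2) : Integrable fun ξ => ‖dampedFreq ε ξ‖ ^ (-s) * ‖fhat (deriv φ) ξ‖ ^ 2 := by
  refine (hφ.integrable_rpow_mul_norm_fhat_sq (s := 2 * (1 - s / 2)) (by linarith)).mono'
    (continuous_dampedEnergy_integrand hφ hε s).aestronglyMeasurable
    (Eventually.of_forall fun ξ => ?_)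
  rw [Real.norm_of_nonneg (by positivity)]
  exact dampedEnergy_integrand_le hφ hs ε ξ

theorem dampedEnergy_le (hφ : IsTestFunction φ) (hε : ε ≠ 0) (hs : 0 ≤ s) (hs2 : s ≤ 2) :
    dampedEnergy ε s φ ≤ seminormSq (1 - s / 2) φ :=
  integral_mono (integrable_dampedEnergy_integrand hφ hε hs hs2)
    (hφ.integrable_rpow_mul_norm_fhat_sq (by linarith)) (dampedEnergy_integrand_le hφ hs ε)

theorem tendsto_dampedEnergy (hφ : IsTestFunction φ) (hs : 0 ≤ s) (hs2 : s ≤ 2) :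
    Tendsto (fun ε => dampedEnergy ε s φ) (𝓝[>] 0) (𝓝 (seminormSq (1 - s / 2) φ)) := by
  refine tendsto_integral_filter_of_dominated_convergence
    (fun ξ => |2 * π * ξ| ^ (2 * (1 - s / 2)) * ‖fhat φ ξ‖ ^ 2)
    (eventually_nhdsWithin_of_forall fun ε hε =>
      (continuous_dampedEnergy_integrand hφ (ne_of_gt hε) s).aestronglyMeasurable)
    (Eventually.of_forall fun ε => Eventually.of_forall fun ξ => ?_)
    (hφ.integrable_rpow_mul_norm_fhat_sq (by linarith)) ?_
  · rw [Real.norm_of_nonneg (by positivity)]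
    exact dampedEnergy_integrand_le hφ hs ε ξ
  · filter_upwards [volume.ae_ne 0] with ξ hξ
    have hω : 0 < |2 * π * ξ| := abs_pos.2 (by positivity)
    have hnorm : ‖dampedFreq 0 ξ‖ = |2 * π * ξ| := by simp [dampedFreq, abs_mul]
    have hcont : ContinuousAt (fun ε => ‖dampedFreq ε ξ‖ ^ (-s)) 0 := by
      refine ContinuousAt.rpow_const ?_ (Or.inl (hnorm.trans_ne hω.ne'))
      simp only [dampedFreq]
      fun_prop
    rw [show 2 * (1 - s / 2) = 2 - s by ring, ← rpow_neg_mul_sq hω, mul_assoc,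
      ← hφ.norm_fhat_deriv_sq, ← hnorm]
    exact (hcont.tendsto.mono_left nhdsWithin_le_nhds).mul_const _

theorem integrable_re_dampedFreq_cpow_mul (hφ : IsTestFunction φ) (hε : 0 < ε) (hs : 0 ≤ s)
    (hs2 : s ≤ 2) :
    Integrable fun ξ => (dampedFreq ε ξ ^ (-s : ℂ)).re * ‖fhat (deriv φ) ξ‖ ^ 2 := by
  refine (integrable_dampedEnergy_integrand hφ hε.ne' hs hs2).mono' ?_
    (Eventually.of_forall fun ξ => ?_)
  · refine Continuous.aestronglyMeasurable
      (Continuous.mul ?_ ((continuous_fhat hφ.deriv.integrable).norm.pow 2))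
    exact Complex.continuous_re.comp ((continuous_dampedFreq ε).cpow continuous_const fun ξ =>
      Or.inl ((re_dampedFreq ε ξ).symm ▸ hε))
  · rw [norm_mul, Real.norm_of_nonneg (by positivity : 0 ≤ ‖fhat (deriv φ) ξ‖ ^ 2)]
    gcongr ?_ * _
    refine (Complex.abs_re_le_norm _).trans_eq ?_
    rw [← Complex.ofReal_neg, Complex.norm_cpow_real]

theorem cos_mul_dampedEnergy_le (hφ : IsTestFunction φ) (hε : 0 < ε) (hs : 0 ≤ s) (hs2 : s ≤ 2) :
    cos (π * s / 2) * dampedEnergy ε s φ ≤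
      ∫ ξ, (dampedFreq ε ξ ^ (-s : ℂ)).re * ‖fhat (deriv φ) ξ‖ ^ 2 := by
  rw [dampedEnergy, ← integral_const_mul]
  refine integral_mono ((integrable_dampedEnergy_integrand hφ hε.ne' hs hs2).const_mul _)
    (integrable_re_dampedFreq_cpow_mul hφ hε hs hs2) fun ξ => ?_
  simp only [← mul_assoc]
  gcongr ?_ * _
  exact cos_mul_norm_rpow_le_re_cpow (dampedFreq_ne_zero hε.ne' ξ) (by simpa using hε.le) hs hs2

end Energy

section FractionalDerivative

variable {β : ℝ} {φ : ℝ → ℝ}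

theorem norm_fhat_dampedKernel (hβ : 0 < β) {ε : ℝ} (hε : 0 < ε) (ξ : ℝ) :
    ‖fhat (dampedKernel β ε) ξ‖ = ‖dampedFreq ε ξ‖ ^ (-β) := by
  rw [fhat_dampedKernel hβ hε, ← Complex.ofReal_neg, Complex.norm_cpow_real]

theorem norm_fhat_refl_dampedKernel (hβ : 0 < β) {ε : ℝ} (hε : 0 < ε) (ξ : ℝ) :
    ‖fhat (refl (dampedKernel β ε)) ξ‖ = ‖dampedFreq ε ξ‖ ^ (-β) := by
  rw [fhat_comp_neg, RCLike.norm_conj, norm_fhat_dampedKernel hβ hε]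

theorem integral_conv_deriv_sq {ε : ℝ} {K : ℝ → ℝ} (hK : Integrable K)
    (hsymbol : ∀ ξ, ‖fhat K ξ‖ = ‖dampedFreq ε ξ‖ ^ (-β)) (hφ : IsTestFunction φ) :
    ∫ x, conv K (deriv φ) x ^ 2 = dampedEnergy ε (2 * β) φ := by
  simp only [sq (conv K _ _), integral_conv_mul_conv hK hK hφ.deriv]
  refine integral_congr_ae (Eventually.of_forall fun ξ => ?_)
  simp only [Complex.conj_mul', hsymbol, ← Complex.ofReal_pow, Complex.ofReal_re]
  rw [← rpow_mul_natCast (norm_nonneg _)]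
  ring_nf

theorem setIntegral_conv_deriv_sq_le {k : ℝ → ℝ → ℝ} {K : ℝ → ℝ} (hβ : 0 ≤ β) (hβ1 : β ≤ 1)
    (hφ : IsTestFunction φ) (hk : ∀ ε > 0, Integrable (k ε))
    (hsymbol : ∀ ε > 0, ∀ ξ, ‖fhat (k ε) ξ‖ = ‖dampedFreq ε ξ‖ ^ (-β))
    (hlim : TendstoBoundedly (fun ε => conv (k ε) (deriv φ)) (𝓝[>] 0) (conv K (deriv φ))
      (volume.restrict (Ioo 0 1))) :
    ∫ x in Ioo (0 : ℝ) 1, conv K (deriv φ) x ^ 2 ≤ seminormSq (1 - β) φ := by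
  have h := hlim.integral_mul hlim
  simp only [← sq] at h
  refine le_of_tendsto h (eventually_nhdsWithin_of_forall fun ε hε => ?_)
  refine (setIntegral_le_integral (integrable_conv_sq (hk ε hε) hφ.deriv)
    (Eventually.of_forall fun x => sq_nonneg _)).trans ?_
  rw [integral_conv_deriv_sq (hk ε hε) (hsymbol ε hε) hφ]
  simpa using dampedEnergy_le (s := 2 * β) hφ (ne_of_gt hε) (by linarith) (by linarith)

theorem integral_conv_intervalKernel_sq_le (hβ : 0 < β) (hβ1 : β ≤ 1) (hφ : IsTestFunction φ) :
    ∫ x in Ioo (0 : ℝ) 1, conv (intervalKernel β) (deriv φ) x ^ 2 ≤ seminormSq (1 - β) φ :=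
  setIntegral_conv_deriv_sq_le hβ.le hβ1 hφ (fun _ hε => integrable_dampedKernel hβ hε)
    (fun _ hε => norm_fhat_dampedKernel hβ hε) (tendstoBoundedly_conv_dampedKernel hβ hφ.deriv)

theorem integral_conv_refl_intervalKernel_sq_le (hβ : 0 < β) (hβ1 : β ≤ 1)
    (hφ : IsTestFunction φ) :
    ∫ x in Ioo (0 : ℝ) 1, conv (refl (intervalKernel β)) (deriv φ) x ^ 2 ≤
      seminormSq (1 - β) φ :=
  setIntegral_conv_deriv_sq_le hβ.le hβ1 hφ
    (fun _ hε => integrable_refl (integrable_dampedKernel hβ hε))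
    (fun _ hε => norm_fhat_refl_dampedKernel hβ hε)
    (tendstoBoundedly_conv_refl_dampedKernel hβ hφ.deriv)

theorem cos_mul_seminormSq_le_of_tendsto {s c : ℝ} {b : ℝ → ℝ} (hs : 0 ≤ s) (hs2 : s ≤ 2)
    (hφ : IsTestFunction φ) (hlim : Tendsto b (𝓝[>] 0) (𝓝 c))
    (hb : ∀ ε > 0, ∫ ξ, (dampedFreq ε ξ ^ (-s : ℂ)).re * ‖fhat (deriv φ) ξ‖ ^ 2 = b ε) :
    cos (π * s / 2) * seminormSq (1 - s / 2) φ ≤ c :=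
  le_of_tendsto_of_tendsto ((tendsto_dampedEnergy hφ hs hs2).const_mul _) hlim
    (eventually_nhdsWithin_of_forall fun ε hε =>
      (cos_mul_dampedEnergy_le hφ hε hs hs2).trans_eq (hb ε hε))

theorem re_conj_fhat_dampedKernel_mul_fhat_refl (hβ : 0 < β) {ε : ℝ} (hε : 0 < ε) (ξ : ℝ) :
    ((starRingEnd ℂ) (fhat (dampedKernel β ε) ξ) * fhat (refl (dampedKernel β ε)) ξ).re =
      (dampedFreq ε ξ ^ (-(2 * β : ℝ) : ℂ)).re := by
  rw [fhat_comp_neg, ← map_mul, Complex.conj_re, fhat_dampedKernel hβ hε,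
    ← Complex.cpow_add _ _ (dampedFreq_ne_zero hε.ne' ξ)]
  congr 2
  push_cast
  ring

theorem setIntegral_conv_dampedKernel_mul_refl (hφ : IsTestFunction φ) (β ε : ℝ) :
    ∫ x in Ioo (0 : ℝ) 1, conv (dampedKernel β ε) φ x * conv (refl (dampedKernel β ε)) φ x =
      ∫ x, conv (dampedKernel β ε) φ x * conv (refl (dampedKernel β ε)) φ x := by
  refine setIntegral_eq_integral_of_forall_compl_eq_zero fun x hx => ?_
  rcases le_or_gt x 0 with h0 | h0
  · rw [conv_dampedKernel_eq_zero hφ h0, zero_mul]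
  · rw [conv_refl_dampedKernel_eq_zero hφ (not_lt.1 fun h1 => hx ⟨h0, h1⟩), mul_zero]

-- The symbols of the left and right integrals are conjugate, so the product of the first with the
-- conjugate of the second is `(ε + iω) ^ (-2β)`, whose argument is at most `πβ`.
theorem cos_mul_seminormSq_le_integral_conv_mul_refl (hβ : 0 < β) (hβ1 : β ≤ 1)
    (hφ : IsTestFunction φ) :
    cos (π * β) * seminormSq (1 - β) φ ≤ ∫ x in Ioo (0 : ℝ) 1,
      conv (intervalKernel β) (deriv φ) x * conv (refl (intervalKernel β)) (deriv φ) x := by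
  have h := cos_mul_seminormSq_le_of_tendsto (s := 2 * β) (by linarith) (by linarith) hφ
    ((tendstoBoundedly_conv_dampedKernel hβ hφ.deriv).integral_mul
      (tendstoBoundedly_conv_refl_dampedKernel hβ hφ.deriv)) fun ε hε => ?_
  · rwa [show π * (2 * β) / 2 = π * β by ring, mul_div_cancel_left₀ β two_ne_zero] at h
  · rw [setIntegral_conv_dampedKernel_mul_refl hφ.deriv,
      integral_conv_mul_conv (integrable_dampedKernel hβ hε)
        (integrable_refl (integrable_dampedKernel hβ hε)) hφ.deriv]
    simp only [re_conj_fhat_dampedKernel_mul_fhat_refl hβ hε]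

theorem cos_mul_seminormSq_le_integral_mul_conv (hβ : 0 < β) (hβ2 : β ≤ 2)
    (hφ : IsTestFunction φ) :
    cos (π * β / 2) * seminormSq (1 - β / 2) φ ≤ ∫ x in Ioo (0 : ℝ) 1,
      deriv φ x * conv (intervalKernel β) (deriv φ) x := by
  refine cos_mul_seminormSq_le_of_tendsto hβ.le hβ2 hφ
    (hφ.deriv.tendstoBoundedly_const.integral_mul
      (tendstoBoundedly_conv_dampedKernel hβ hφ.deriv)) fun ε hε => ?_
  rw [hφ.deriv.setIntegral_eq fun x hx => by rw [hx, zero_mul],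
    integral_mul_conv (integrable_dampedKernel hβ hε) hφ.deriv]
  simp only [fhat_dampedKernel hβ hε]

theorem cos_mul_seminormSq_le_integral_mul_conv_refl (hβ : 0 < β) (hβ2 : β ≤ 2)
    (hφ : IsTestFunction φ) :
    cos (π * β / 2) * seminormSq (1 - β / 2) φ ≤ ∫ x in Ioo (0 : ℝ) 1,
      deriv φ x * conv (refl (intervalKernel β)) (deriv φ) x := by
  refine cos_mul_seminormSq_le_of_tendsto hβ.le hβ2 hφ
    (hφ.deriv.tendstoBoundedly_const.integral_mul
      (tendstoBoundedly_conv_refl_dampedKernel hβ hφ.deriv)) fun ε hε => ?_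
  rw [hφ.deriv.setIntegral_eq fun x hx => by rw [hx, zero_mul],
    integral_mul_conv (integrable_refl (integrable_dampedKernel hβ hε)) hφ.deriv]
  simp only [fhat_comp_neg, Complex.conj_re, fhat_dampedKernel hβ hε]

end FractionalDerivative

section BetaWeight

variable {p q : ℝ}

/-- The density `s ^ (p - 1) * (1 - s) ^ (q - 1)` of the beta integral, without the normalizing
factor. -/
def betaWeight (p q s : ℝ) : ℝ := s ^ (p - 1) * (1 - s) ^ (q - 1)

@[fun_prop]
theorem measurable_betaWeight (p q : ℝ) : Measurable (betaWeight p q) := by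
  unfold betaWeight
  fun_prop

theorem betaWeight_one_sub (p q s : ℝ) : betaWeight p q (1 - s) = betaWeight q p s := by
  rw [betaWeight, betaWeight, sub_sub_cancel, mul_comm]

theorem betaWeight_nonneg {s : ℝ} (hs : s ∈ Ioo (0 : ℝ) 1) : 0 ≤ betaWeight p q s :=
  mul_nonneg (rpow_nonneg hs.1.le _) (rpow_nonneg (by linarith [hs.2]) _)

theorem ofReal_betaWeight {s : ℝ} (hs : s ∈ Ioo (0 : ℝ) 1) :
    (betaWeight p q s : ℂ) = (s : ℂ) ^ ((p : ℂ) - 1) * (1 - (s : ℂ)) ^ ((q : ℂ) - 1) := by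
  rw [betaWeight, Complex.ofReal_mul, Complex.ofReal_cpow hs.1.le,
    Complex.ofReal_cpow (by linarith [hs.2])]
  push_cast
  rfl

theorem integrableOn_betaWeight (hp : 0 < p) (hq : 0 < q) :
    IntegrableOn (betaWeight p q) (Ioo 0 1) := by
  have h := Complex.betaIntegral_convergent (u := p) (v := q) (by simpa) (by simpa)
  rw [intervalIntegrable_iff_integrableOn_Ioo_of_le zero_le_one] at h
  refine IntegrableOn.congr_fun h.re (fun s hs => ?_) measurableSet_Ioo
  rw [← ofReal_betaWeight hs]
  exact Complex.ofReal_re _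

theorem integral_betaWeight (hp : 0 < p) (hq : 0 < q) :
    ∫ s in Ioo (0 : ℝ) 1, betaWeight p q s = ProbabilityTheory.beta p q := by
  rw [ProbabilityTheory.beta_eq_betaIntegralReal p q hp hq, Complex.betaIntegral,
    intervalIntegral.integral_of_le zero_le_one, integral_Ioc_eq_integral_Ioo,
    ← setIntegral_congr_fun measurableSet_Ioo fun s hs => ofReal_betaWeight hs,
    integral_complex_ofReal, Complex.ofReal_re]

end BetaWeight

section Moebius

variable {p q x τ : ℝ}

theorem one_sub_mul_pos (hx : x < 1) (hτ : τ ∈ Ioo (0 : ℝ) 1) : 0 < 1 - x * τ := by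
  nlinarith [mul_pos hτ.1 (sub_pos.2 hx), hτ.2]

/-- The Möbius transformation which fixes `0` and `1` and has derivative `1 - x` at `0`. -/
def moebius (x τ : ℝ) : ℝ := (1 - x) * τ / (1 - x * τ)

theorem one_sub_moebius (hx : x < 1) (hτ : τ ∈ Ioo (0 : ℝ) 1) :
    1 - moebius x τ = (1 - τ) / (1 - x * τ) := by
  have := (one_sub_mul_pos hx hτ).ne'
  rw [moebius]
  field_simp
  ring

theorem moebius_mem_Ioo (hx : x < 1) (hτ : τ ∈ Ioo (0 : ℝ) 1) : moebius x τ ∈ Ioo (0 : ℝ) 1 := by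
  have hpos := one_sub_mul_pos hx hτ
  refine ⟨div_pos (mul_pos (sub_pos.2 hx) hτ.1) hpos, sub_pos.1 ?_⟩
  rw [one_sub_moebius hx hτ]
  exact div_pos (sub_pos.2 hτ.2) hpos

theorem moebius_moebius (hx : x < 1) (hτ : τ ∈ Ioo (0 : ℝ) 1) :
    moebius (x / (x - 1)) (moebius x τ) = τ := by
  have hpos := (one_sub_mul_pos hx hτ).ne'
  have hx' : x - 1 ≠ 0 := by linarith
  have hden : 1 - x / (x - 1) * moebius x τ = 1 / (1 - x * τ) := by
    rw [moebius]
    field_simp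
    ring
  rw [moebius, hden, moebius]
  field_simp
  ring

theorem bijOn_moebius (hx : x < 1) : BijOn (moebius x) (Ioo 0 1) (Ioo 0 1) := by
  have hx' : x - 1 < 0 := by linarith
  have hy : x / (x - 1) < 1 := by rw [div_lt_iff_of_neg hx']; linarith
  have hxy : x / (x - 1) / (x / (x - 1) - 1) = x := by
    rw [show x / (x - 1) - 1 = 1 / (x - 1) by field_simp [hx'.ne]; ring]
    field_simp [hx'.ne]
  refine InvOn.bijOn (f' := moebius (x / (x - 1))) ⟨fun τ hτ => moebius_moebius hx hτ,
    fun τ hτ => ?_⟩ (fun τ hτ => moebius_mem_Ioo hx hτ) fun τ hτ => moebius_mem_Ioo hy hτ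
  simpa only [hxy] using moebius_moebius hy hτ

theorem hasDerivAt_moebius (hx : x < 1) (hτ : τ ∈ Ioo (0 : ℝ) 1) :
    HasDerivAt (moebius x) ((1 - x) / (1 - x * τ) ^ 2) τ := by
  have hnum : HasDerivAt (fun τ : ℝ => (1 - x) * τ) (1 - x) τ := by
    simpa using (hasDerivAt_id τ).const_mul (1 - x)
  have hden : HasDerivAt (fun τ : ℝ => 1 - x * τ) (-x) τ := by
    simpa using ((hasDerivAt_id τ).const_mul x).const_sub 1
  refine (hnum.fun_div hden (one_sub_mul_pos hx hτ).ne').congr_deriv ?_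
  congr 1
  ring

theorem deriv_moebius_mul_betaWeight (hx : x < 1) (hτ : τ ∈ Ioo (0 : ℝ) 1) :
    (1 - x) / (1 - x * τ) ^ 2 * betaWeight p q (moebius x τ) =
      (1 - x) ^ p * (betaWeight p q τ * (1 - x * τ) ^ (-(p + q))) := by
  have hx' : 0 < 1 - x := sub_pos.2 hx
  have hpos := one_sub_mul_pos hx hτ
  have hpow : (1 - x * τ) ^ (p + q) =
      (1 - x * τ) ^ (p - 1) * (1 - x * τ) ^ (q - 1) * (1 - x * τ) ^ 2 := by
    rw [← rpow_two, ← rpow_add hpos, ← rpow_add hpos]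
    ring_nf
  rw [betaWeight, one_sub_moebius hx hτ, moebius, div_rpow (mul_pos hx' hτ.1).le hpos.le,
    mul_rpow hx'.le hτ.1.le, div_rpow (sub_pos.2 hτ.2).le hpos.le, rpow_neg hpos.le, hpow,
    betaWeight, rpow_sub_one hx'.ne']
  field_simp

theorem setIntegral_betaWeight_mul_rpow (hx : x < 1) :
    ∫ τ in Ioo (0 : ℝ) 1, betaWeight p q τ * (1 - x * τ) ^ (-(p + q)) =
      (1 - x) ^ (-p) * ∫ s in Ioo (0 : ℝ) 1, betaWeight p q s := by
  have hx' : 0 < 1 - x := sub_pos.2 hx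
  have hsubst := integral_image_eq_integral_abs_deriv_smul measurableSet_Ioo
    (fun τ hτ => (hasDerivAt_moebius hx hτ).hasDerivWithinAt) (bijOn_moebius hx).injOn
    (betaWeight p q)
  rw [(bijOn_moebius hx).image_eq] at hsubst
  rw [hsubst, rpow_neg hx'.le, eq_inv_mul_iff_mul_eq₀ (rpow_pos_of_pos hx' p).ne',
    ← integral_const_mul]
  refine setIntegral_congr_fun measurableSet_Ioo fun τ hτ => ?_
  have := one_sub_mul_pos hx hτ
  simp only [smul_eq_mul]
  rw [abs_of_pos (by positivity), deriv_moebius_mul_betaWeight hx hτ]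

end Moebius

section EulerIntegral

variable {p q x : ℝ}

/-- Euler's integral, which is the hypergeometric function `₂F₁(-r, p; p + q; x)` up to
normalization. -/
def eulerIntegral (p q r x : ℝ) : ℝ :=
  ∫ τ in Ioo (0 : ℝ) 1, betaWeight p q τ * (1 - x * τ) ^ r

theorem eulerIntegral_neg_add (hp : 0 < p) (hq : 0 < q) (hx : x < 1) :
    eulerIntegral p q (-(p + q)) x = (1 - x) ^ (-p) * ProbabilityTheory.beta p q := by
  rw [eulerIntegral, setIntegral_betaWeight_mul_rpow hx, integral_betaWeight hp hq]

theorem rpow_le_one_add_rpow {d y : ℝ} (hd : 0 < d) (hdy : d ≤ y) (hy : y ≤ 1) (r : ℝ) :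
    y ^ r ≤ 1 + d ^ r := by
  have hd' := rpow_nonneg hd.le r
  rcases le_total 0 r with hr | hr
  · linarith [rpow_le_one (hd.le.trans hdy) hy hr]
  · linarith [rpow_le_rpow_of_nonpos hd hdy hr]

theorem one_sub_mul_rpow_le {d τ : ℝ} (hd : 0 < d) (hx : 0 ≤ x) (hxd : d ≤ 1 - x)
    (hτ : τ ∈ Ioo (0 : ℝ) 1) (r : ℝ) : (1 - x * τ) ^ r ≤ 1 + d ^ r :=
  rpow_le_one_add_rpow hd (by nlinarith [hτ.2]) (by nlinarith [hτ.1]) r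

theorem integrableOn_betaWeight_mul_rpow (hp : 0 < p) (hq : 0 < q) (r : ℝ)
    (hx : x ∈ Ico (0 : ℝ) 1) :
    IntegrableOn (fun τ => betaWeight p q τ * (1 - x * τ) ^ r) (Ioo 0 1) := by
  refine Integrable.mul_bdd (c := 1 + (1 - x) ^ r) (integrableOn_betaWeight hp hq)
    (Measurable.aestronglyMeasurable (by fun_prop)) ?_
  filter_upwards [ae_restrict_mem measurableSet_Ioo] with τ hτ
  rw [Real.norm_of_nonneg (rpow_nonneg (one_sub_mul_pos hx.2 hτ).le _)]
  exact one_sub_mul_rpow_le (sub_pos.2 hx.2) hx.1 le_rfl hτ r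

theorem abs_mul_one_sub_mul_rpow_le {d τ : ℝ} (hd : 0 < d) (hx : 0 ≤ x) (hxd : d ≤ 1 - x)
    (hτ : τ ∈ Ioo (0 : ℝ) 1) (p q r : ℝ) :
    |betaWeight p q τ * (-(r * τ) * (1 - x * τ) ^ (r - 1))| ≤
      betaWeight p q τ * (|r| * (1 + d ^ (r - 1))) := by
  rw [abs_mul, abs_of_nonneg (betaWeight_nonneg hτ), abs_mul, abs_neg, abs_mul,
    abs_of_pos hτ.1, abs_of_nonneg (rpow_nonneg (one_sub_mul_pos (by linarith) hτ).le _)]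
  exact mul_le_mul_of_nonneg_left (mul_le_mul (mul_le_of_le_one_right (abs_nonneg _) hτ.2.le)
    (one_sub_mul_rpow_le hd hx hxd hτ _)
    (rpow_nonneg (one_sub_mul_pos (by linarith) hτ).le _) (abs_nonneg _)) (betaWeight_nonneg hτ)

theorem hasDerivAt_eulerIntegral_under_integral (hp : 0 < p) (hq : 0 < q) (r : ℝ)
    (hx : x ∈ Ioo (0 : ℝ) 1) :
    HasDerivAt (eulerIntegral p q r)
      (∫ τ in Ioo (0 : ℝ) 1, betaWeight p q τ * (-(r * τ) * (1 - x * τ) ^ (r - 1))) x := by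
  set d := (1 - x) / 2 with hd
  have hd0 : 0 < d := by linarith [hx.2]
  refine (hasDerivAt_integral_of_dominated_loc_of_deriv_le
    (μ := volume.restrict (Ioo (0 : ℝ) 1)) (s := Ioo 0 (x + d))
    (F := fun x τ => betaWeight p q τ * (1 - x * τ) ^ r)
    (F' := fun x τ => betaWeight p q τ * (-(r * τ) * (1 - x * τ) ^ (r - 1)))
    (bound := fun τ => betaWeight p q τ * (|r| * (1 + d ^ (r - 1))))
    (Ioo_mem_nhds hx.1 (by linarith))
    (Eventually.of_forall fun y => Measurable.aestronglyMeasurable (by fun_prop))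
    (integrableOn_betaWeight_mul_rpow hp hq r ⟨hx.1.le, hx.2⟩)
    (Measurable.aestronglyMeasurable (by fun_prop)) ?_
    ((integrableOn_betaWeight hp hq).mul_const _) ?_).2
  · filter_upwards [ae_restrict_mem measurableSet_Ioo] with τ hτ y hy
    exact abs_mul_one_sub_mul_rpow_le hd0 hy.1.le (by linarith [hy.2]) hτ p q r
  · filter_upwards [ae_restrict_mem measurableSet_Ioo] with τ hτ y hy
    have hlin : HasDerivAt (fun y : ℝ => 1 - y * τ) (-τ) y := by
      simpa using ((hasDerivAt_id y).mul_const τ).const_sub 1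
    refine ((hlin.rpow_const (p := r)
      (Or.inl (one_sub_mul_pos (by linarith [hy.2]) hτ).ne')).const_mul _).congr_deriv ?_
    ring

theorem hasDerivAt_eulerIntegral (hp : 0 < p) (hq : 0 < q) (r : ℝ) (hx : x ∈ Ioo (0 : ℝ) 1) :
    HasDerivAt (eulerIntegral p q r)
      (r / x * (eulerIntegral p q r x - eulerIntegral p q (r - 1) x)) x := by
  refine (hasDerivAt_eulerIntegral_under_integral hp hq r hx).congr_deriv ?_
  rw [eulerIntegral, eulerIntegral,
    ← integral_sub (integrableOn_betaWeight_mul_rpow hp hq r ⟨hx.1.le, hx.2⟩)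
      (integrableOn_betaWeight_mul_rpow hp hq (r - 1) ⟨hx.1.le, hx.2⟩), ← integral_const_mul]
  refine setIntegral_congr_fun measurableSet_Ioo fun τ hτ => ?_
  have hpow : (1 - x * τ) ^ r = (1 - x * τ) ^ (r - 1) * (1 - x * τ) := by
    rw [← rpow_add_one (one_sub_mul_pos hx.2 hτ).ne', sub_add_cancel]
  have := hx.1.ne'
  simp only [hpow]
  field_simp
  ring

theorem hasDerivAt_rpow_mul_eulerIntegral (hp : 0 < p) (hq : 0 < q) (r : ℝ)
    (hx : x ∈ Ioo (0 : ℝ) 1) :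
    HasDerivAt (fun x => x ^ (-r) * eulerIntegral p q r x)
      (-r * x ^ (-r - 1) * eulerIntegral p q (r - 1) x) x := by
  have hx0 := hx.1.ne'
  refine ((hasDerivAt_rpow_const (Or.inl hx0)).mul
    (hasDerivAt_eulerIntegral hp hq r hx)).congr_deriv ?_
  rw [rpow_sub_one hx0]
  field_simp
  ring

end EulerIntegral

section FractionalIntegral

variable {β θ p q x : ℝ}

theorem leftFracInt_eq_conv (f : ℝ → ℝ) (hx : x ∈ Ioo (0 : ℝ) 1) :
    leftFracInt β f x = conv (intervalKernel β) ((Ioo (0 : ℝ) 1).indicator f) x := by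
  rw [leftFracInt, conv_apply_swap, ← integral_const_mul, ← integral_indicator measurableSet_Ioo]
  refine integral_congr_ae (Eventually.of_forall fun s => ?_)
  simp only [intervalKernel, indicator_apply, mem_Ioo]
  by_cases hs : 0 < s ∧ s < x
  · rw [if_pos hs, if_pos ⟨sub_pos.2 hs.2, by linarith [hs.1, hx.2]⟩,
      if_pos ⟨hs.1, hs.2.trans hx.2⟩, ← neg_sub 1 β, rpow_neg (sub_pos.2 hs.2).le]
    ring
  · rw [if_neg hs]
    by_cases hs0 : 0 < s
    · rw [if_neg fun h : 0 < x - s ∧ x - s < 1 => hs ⟨hs0, sub_pos.1 h.1⟩, zero_mul]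
    · rw [if_neg fun h : 0 < s ∧ s < 1 => hs0 h.1, mul_zero]

theorem rightFracInt_eq_leftFracInt (f : ℝ → ℝ) (hx : x ≤ 1) :
    rightFracInt β f x = leftFracInt β (fun s => f (1 - s)) (1 - x) := by
  have h := intervalIntegral.integral_comp_sub_left (a := x) (b := 1)
    (fun s => f (1 - s) / (1 - x - s) ^ (1 - β)) 1
  rw [sub_self, intervalIntegral.integral_of_le hx,
    intervalIntegral.integral_of_le (sub_nonneg.2 hx), integral_Ioc_eq_integral_Ioo,
    integral_Ioc_eq_integral_Ioo] at h
  rw [rightFracInt, leftFracInt, ← h]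
  simp only [sub_sub_cancel, sub_sub_sub_cancel_left]

theorem one_sub_mem_Ioo : 1 - x ∈ Ioo (0 : ℝ) 1 ↔ x ∈ Ioo (0 : ℝ) 1 := by
  rw [mem_Ioo, mem_Ioo, sub_pos, sub_lt_self_iff, and_comm]

theorem rightFracInt_eq_conv (f : ℝ → ℝ) (hx : x ∈ Ioo (0 : ℝ) 1) :
    rightFracInt β f x = conv (refl (intervalKernel β)) ((Ioo (0 : ℝ) 1).indicator f) x := by
  rw [rightFracInt_eq_leftFracInt f hx.2.le, leftFracInt_eq_conv _ (one_sub_mem_Ioo.2 hx),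
    conv_refl]
  congr 1
  ext y
  simp only [indicator_apply, one_sub_mem_Ioo]

/-- The convolution kernel of `I^β_θ` on the interval `(0,1)`. -/
def twoSidedKernel (β θ t : ℝ) : ℝ :=
  θ * intervalKernel β t + (1 - θ) * intervalKernel β (-t)

theorem integrable_twoSidedKernel (hβ : 0 < β) (θ : ℝ) : Integrable (twoSidedKernel β θ) :=
  ((integrable_intervalKernel hβ).const_mul θ).add
    ((integrable_refl (integrable_intervalKernel hβ)).const_mul (1 - θ))

theorem refl_twoSidedKernel (β θ : ℝ) :
    refl (twoSidedKernel β θ) = twoSidedKernel β (1 - θ) := by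
  ext t
  simp only [refl, twoSidedKernel, neg_neg, sub_sub_cancel]
  ring

theorem ae_conv_twoSidedKernel {f : ℝ → ℝ} (hβ : 0 < β) (hf : Integrable f) (θ : ℝ) :
    ∀ᵐ x, conv (twoSidedKernel β θ) f x =
      θ * conv (intervalKernel β) f x + (1 - θ) * conv (refl (intervalKernel β)) f x := by
  have hK := integrable_intervalKernel hβ
  filter_upwards [hK.ae_convolution_exists (ContinuousLinearMap.mul ℝ ℝ) hf,
    (integrable_refl hK).ae_convolution_exists (ContinuousLinearMap.mul ℝ ℝ) hf] with x hl hr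
  have hadd := integral_add (Integrable.const_mul hl θ) (Integrable.const_mul hr (1 - θ))
  rw [integral_const_mul, integral_const_mul] at hadd
  refine Eq.trans ?_ hadd
  refine integral_congr_ae (Eventually.of_forall fun t => ?_)
  simp only [twoSidedKernel, refl, ContinuousLinearMap.mul_apply']
  ring

theorem twoSidedFracInt_ae_eq_conv {f : ℝ → ℝ} (hβ : 0 < β) (hf : IntegrableOn f (Ioo 0 1))
    (θ : ℝ) : twoSidedFracInt β θ f =ᵐ[volume.restrict (Ioo 0 1)]
      conv (twoSidedKernel β θ) ((Ioo (0 : ℝ) 1).indicator f) := by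
  filter_upwards [ae_restrict_mem measurableSet_Ioo,
    ae_restrict_of_ae (ae_conv_twoSidedKernel hβ (hf.integrable_indicator measurableSet_Ioo) θ)]
    with x hx hconv
  rw [hconv, twoSidedFracInt, leftFracInt_eq_conv f hx, rightFracInt_eq_conv f hx]

theorem leftFracInt_betaWeight (p q : ℝ) (hx : x ∈ Ioo (0 : ℝ) 1) :
    leftFracInt β (betaWeight p q) x =
      1 / Gamma β * (x ^ (p + β - 1) * eulerIntegral p β (q - 1) x) := by
  have hx0 := hx.1
  have h := intervalIntegral.mul_integral_comp_mul_left (a := 0) (b := 1) (c := x)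
    (f := fun s => betaWeight p q s / (x - s) ^ (1 - β))
  rw [mul_zero, mul_one, intervalIntegral.integral_of_le hx0.le,
    intervalIntegral.integral_of_le (zero_le_one' ℝ), integral_Ioc_eq_integral_Ioo,
    integral_Ioc_eq_integral_Ioo] at h
  rw [leftFracInt, ← h, eulerIntegral]
  congr 1
  rw [← integral_const_mul, ← integral_const_mul]
  refine setIntegral_congr_fun measurableSet_Ioo fun τ hτ => ?_
  have hτ' : 0 < 1 - τ := sub_pos.2 hτ.2
  have hpow : x ^ (p + β - 1) = x * (x ^ (p - 1) * (x ^ (1 - β))⁻¹) := by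
    rw [← rpow_neg hx0.le, ← rpow_add hx0, mul_comm, ← rpow_add_one hx0.ne']
    ring_nf
  simp only [betaWeight]
  rw [hpow, ← mul_one_sub, mul_rpow hx0.le hτ.1.le, mul_rpow hx0.le hτ'.le, ← neg_sub 1 β,
    rpow_neg hτ'.le]
  ring

theorem one_sub_mul_beta (hq : 0 < q) (hq1 : q ≤ 1) (hpq : p + q = 2 - β) :
    (1 - q) * ProbabilityTheory.beta p β = Gamma β * (Gamma p * Gamma q * sin (π * q) / π) := by
  rcases hq1.eq_or_lt with rfl | hq1
  · simp
  have hsin : 0 < sin (π * q) :=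
    sin_pos_of_pos_of_lt_pi (by positivity) (mul_lt_of_lt_one_right pi_pos hq1)
  have hreflection : Gamma q * Gamma (1 - q) * sin (π * q) = π := by
    rw [Gamma_mul_Gamma_one_sub, div_mul_cancel₀ _ hsin.ne']
  have hrec : Gamma (p + β) = (1 - q) * Gamma (1 - q) := by
    rw [← Gamma_add_one (by linarith), show p + β = 1 - q + 1 by linarith]
  have hΓ := (Gamma_pos_of_pos (sub_pos.2 hq1)).ne'
  have hq' : 1 - q ≠ 0 := by linarith
  rw [ProbabilityTheory.beta, hrec]
  rw [mul_comm π q] at hreflection ⊢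
  field_simp
  linear_combination -(Gamma p * Gamma β) * hreflection

theorem hasDerivAt_leftFracInt_betaWeight (hβ : 0 < β) (hp : 0 < p) (hq : 0 < q) (hq1 : q ≤ 1)
    (hpq : p + q = 2 - β) (hx : x ∈ Ioo (0 : ℝ) 1) :
    HasDerivAt (leftFracInt β (betaWeight p q))
      (Gamma p * Gamma q / π * (x ^ (-q) * (1 - x) ^ (-p)) * sin (π * q)) x := by
  have hder := (hasDerivAt_rpow_mul_eulerIntegral hp hβ (q - 1) hx).const_mul (1 / Gamma β)
  have hexp : -(q - 1) = p + β - 1 := by linarith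
  rw [show q - 1 - 1 = -(p + β) by linarith, eulerIntegral_neg_add hp hβ hx.2,
    show -(q - 1) - 1 = -q by ring] at hder
  refine (hder.congr_of_eventuallyEq ?_).congr_deriv ?_
  · filter_upwards [Ioo_mem_nhds hx.1 hx.2] with y hy
    rw [leftFracInt_betaWeight p q hy, hexp]
  · have hΓ := (Gamma_pos_of_pos hβ).ne'
    calc _ = 1 / Gamma β * ((1 - q) * ProbabilityTheory.beta p β) *
          (x ^ (-q) * (1 - x) ^ (-p)) := by ring
      _ = _ := by
          rw [one_sub_mul_beta hq hq1 hpq]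
          field_simp

theorem hasDerivAt_rightFracInt_betaWeight (hβ : 0 < β) (hp : 0 < p) (hp1 : p ≤ 1) (hq : 0 < q)
    (hpq : p + q = 2 - β) (hx : x ∈ Ioo (0 : ℝ) 1) :
    HasDerivAt (rightFracInt β (betaWeight p q))
      (-(Gamma p * Gamma q / π * (x ^ (-q) * (1 - x) ^ (-p)) * sin (π * p))) x := by
  have hder := (hasDerivAt_leftFracInt_betaWeight hβ hq hp hp1 (by linarith)
    (one_sub_mem_Ioo.2 hx)).comp x ((hasDerivAt_id x).const_sub 1)
  refine (hder.congr_of_eventuallyEq ?_).congr_deriv ?_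
  · filter_upwards [Iio_mem_nhds hx.2] with y hy
    rw [rightFracInt_eq_leftFracInt _ hy.le]
    simp only [betaWeight_one_sub, Function.comp_apply]
  · rw [sub_sub_cancel]
    ring

theorem exists_twoSidedFracInt_betaWeight_eq (hβ : 0 < β) (hp : p ∈ Ioc (0 : ℝ) 1)
    (hq : q ∈ Ioc (0 : ℝ) 1) (hpq : p + q = 2 - β)
    (hθ : θ * sin (π * q) = (1 - θ) * sin (π * p)) :
    ∃ c, ∀ x ∈ Ioo (0 : ℝ) 1, twoSidedFracInt β θ (betaWeight p q) x = c := by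
  have hder : ∀ x ∈ Ioo (0 : ℝ) 1, HasDerivAt (twoSidedFracInt β θ (betaWeight p q)) 0 x := by
    intro x hx
    refine (((hasDerivAt_leftFracInt_betaWeight hβ hp.1 hq.1 hq.2 hpq hx).const_mul θ).add
      ((hasDerivAt_rightFracInt_betaWeight hβ hp.1 hp.2 hq.1 hpq hx).const_mul (1 - θ))).congr_deriv
        ?_
    linear_combination (Gamma p * Gamma q / π * (x ^ (-q) * (1 - x) ^ (-p))) * hθ
  exact isOpen_Ioo.exists_is_const_of_deriv_eq_zero isPreconnected_Ioo
    (fun x hx => (hder x hx).differentiableAt.differentiableWithinAt) fun x hx => (hder x hx).deriv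

theorem exists_mul_sin_eq_mul_sin (hβ : 0 ≤ β) (hβ1 : β ≤ 1) (hθ : θ ∈ Icc (0 : ℝ) 1) :
    ∃ p ∈ Icc (1 - β) 1, ∃ q ∈ Icc (1 - β) 1,
      p + q = 2 - β ∧ (1 - θ) * sin (π * q) = θ * sin (π * p) := by
  have hsin : 0 ≤ sin (π * (1 - β)) :=
    sin_nonneg_of_nonneg_of_le_pi (mul_nonneg pi_pos.le (by linarith))
      (mul_le_of_le_one_right pi_pos.le (by linarith))
  have hcont : Continuous fun p => (1 - θ) * sin (π * (2 - β - p)) - θ * sin (π * p) := by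
    fun_prop
  have hmem : (0 : ℝ) ∈ Icc ((1 - θ) * sin (π * (2 - β - (1 - β))) - θ * sin (π * (1 - β)))
      ((1 - θ) * sin (π * (2 - β - 1)) - θ * sin (π * 1)) := by
    rw [show 2 - β - (1 - β) = 1 by ring, show 2 - β - 1 = 1 - β by ring, mul_one, sin_pi]
    constructor <;> nlinarith [hθ.1, hθ.2]
  obtain ⟨p, hp, hp0⟩ := intermediate_value_Icc (by linarith) hcont.continuousOn hmem
  exact ⟨p, hp, 2 - β - p, ⟨by linarith [hp.2], by linarith [hp.1]⟩, by ring, sub_eq_zero.1 hp0⟩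

end FractionalIntegral

section Annihilator

variable {K f ψ φ : ℝ → ℝ}

theorem integral_conv_mul (hK : Integrable K) (hf : Integrable f) (hψ : Continuous ψ) {B : ℝ}
    (hB : ∀ x, |ψ x| ≤ B) : ∫ x, conv K f x * ψ x = ∫ x, f x * conv (refl K) ψ x := by
  have hint : Integrable (fun z : ℝ × ℝ => f z.2 * K (z.1 - z.2) * ψ z.1) (volume.prod volume) :=
    (hf.convolution_integrand (ContinuousLinearMap.mul ℝ ℝ) hK).mul_bdd
      (hψ.comp continuous_fst).aestronglyMeasurable (Eventually.of_forall fun z => hB z.1)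
  calc ∫ x, conv K f x * ψ x = ∫ x, ∫ s, f s * K (x - s) * ψ x := by
        simp only [conv_apply_swap, mul_comm (K _) (f _), integral_mul_const]
    _ = ∫ s, ∫ x, f s * K (x - s) * ψ x :=
        integral_integral_swap (f := fun x s => f s * K (x - s) * ψ x) hint
    _ = ∫ s, f s * conv (refl K) ψ s := by
        simp only [conv_apply_swap, refl, neg_sub, mul_assoc, integral_const_mul]

theorem IsTestFunction.setIntegral_conv_mul (hφ : IsTestFunction φ) (hK : Integrable K)
    (hf : IntegrableOn f (Ioo 0 1)) :
    ∫ x in Ioo (0 : ℝ) 1, conv K ((Ioo (0 : ℝ) 1).indicator f) x * φ x =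
      ∫ x in Ioo (0 : ℝ) 1, f x * conv (refl K) φ x := by
  obtain ⟨B, hB⟩ := hφ.exists_abs_le
  rw [hφ.setIntegral_eq fun x hx => by rw [hx, mul_zero],
    integral_conv_mul hK (hf.integrable_indicator measurableSet_Ioo) hφ.continuous hB,
    ← integral_indicator measurableSet_Ioo]
  simp only [indicator_mul_left]

theorem IsTestFunction.integral_deriv (hφ : IsTestFunction φ) : ∫ x, _root_.deriv φ x = 0 :=
  integral_eq_zero_of_hasDerivAt_of_integrable (fun x => (hφ.differentiable x).hasDerivAt)
    hφ.deriv.integrable hφ.integrable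

theorem setIntegral_betaWeight_mul_conv_deriv {β θ p q : ℝ} (hβ : 0 < β) (hp : p ∈ Ioc (0 : ℝ) 1)
    (hq : q ∈ Ioc (0 : ℝ) 1) (hpq : p + q = 2 - β) (hθ : (1 - θ) * sin (π * q) = θ * sin (π * p))
    (hφ : IsTestFunction φ) :
    ∫ x in Ioo (0 : ℝ) 1, betaWeight p q x * conv (twoSidedKernel β θ) (deriv φ) x = 0 := by
  obtain ⟨c, hc⟩ := exists_twoSidedFracInt_betaWeight_eq hβ hp hq hpq (θ := 1 - θ) (by simpa)
  have hw : IntegrableOn (betaWeight p q) (Ioo 0 1) := integrableOn_betaWeight hp.1 hq.1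
  have hrefl : twoSidedKernel β θ = refl (twoSidedKernel β (1 - θ)) := by
    rw [refl_twoSidedKernel, sub_sub_cancel]
  calc _ = ∫ x in Ioo (0 : ℝ) 1, twoSidedFracInt β (1 - θ) (betaWeight p q) x * deriv φ x := by
        rw [hrefl, ← hφ.deriv.setIntegral_conv_mul (integrable_twoSidedKernel hβ _) hw]
        refine integral_congr_ae ?_
        filter_upwards [twoSidedFracInt_ae_eq_conv hβ hw (1 - θ)] with x hx
        rw [hx]
    _ = ∫ x in Ioo (0 : ℝ) 1, c * deriv φ x :=
        setIntegral_congr_fun measurableSet_Ioo fun x hx => by simp only [hc x hx]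
    _ = 0 := by
        rw [integral_const_mul, hφ.deriv.setIntegral_eq fun x hx => hx, hφ.integral_deriv, mul_zero]

end Annihilator

section InnerProductSpace

variable {E : Type*} [NormedAddCommGroup E] [InnerProductSpace ℝ E] {g h k e G : E}

-- Subtracting a multiple of `h` from `z` makes `z` orthogonal to `e` and leaves `⟪G, z⟫` unchanged.
theorem inner_le_norm_sub_smul_mul (he : ‖e‖ = 1) (hhe : 1 ≤ inner ℝ h e)
    (hG : inner ℝ G h = 0) (z : E) (c : ℝ) :
    inner ℝ G z ≤ ‖G - c • e‖ * (‖z‖ * (1 + ‖h‖)) := by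
  set a : ℝ := inner ℝ z e / inner ℝ h e
  have ha : |a| ≤ ‖z‖ := by
    rw [abs_div, abs_of_pos (zero_lt_one.trans_le hhe)]
    exact (div_le_self (abs_nonneg _) hhe).trans
      ((abs_real_inner_le_norm z e).trans_eq (by rw [he, mul_one]))
  have hnorm : ‖z - a • h‖ ≤ ‖z‖ * (1 + ‖h‖) := calc
    ‖z - a • h‖ ≤ ‖z‖ + |a| * ‖h‖ := by
      simpa only [norm_smul, Real.norm_eq_abs] using norm_sub_le z (a • h)
    _ ≤ ‖z‖ + ‖z‖ * ‖h‖ := by gcongr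
    _ = ‖z‖ * (1 + ‖h‖) := by ring
  have horth : inner ℝ e (z - a • h) = 0 := by
    rw [real_inner_comm, inner_sub_left, real_inner_smul_left,
      div_mul_cancel₀ _ (zero_lt_one.trans_le hhe).ne', sub_self]
  calc inner ℝ G z = inner ℝ (G - c • e) (z - a • h) := by
        rw [inner_sub_left, real_inner_smul_left, horth, mul_zero, sub_zero, inner_sub_right,
          real_inner_smul_right, hG, mul_zero, sub_zero]
    _ ≤ ‖G - c • e‖ * ‖z - a • h‖ := real_inner_le_norm _ _
    _ ≤ ‖G - c • e‖ * (‖z‖ * (1 + ‖h‖)) := by gcongr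

theorem inner_le_inner_convexCombination_add {θ : ℝ} (hθ : θ ∈ Icc (0 : ℝ) 1) (g k : E) :
    inner ℝ g k ≤ inner ℝ (θ • g + (1 - θ) • k) (g + k) := by
  have hg := mul_nonneg hθ.1 (sq_nonneg ‖g‖)
  have hk := mul_nonneg (sub_nonneg.2 hθ.2) (sq_nonneg ‖k‖)
  simp only [inner_add_left, inner_add_right, real_inner_smul_left, real_inner_self_eq_norm_sq,
    real_inner_comm g k]
  linarith

theorem le_norm_convexCombination_sub_smul {N M C θ : ℝ} (hθ : θ ∈ Icc (0 : ℝ) 1) (hN : 0 ≤ N)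
    (he : ‖e‖ = 1) (hM : ‖h‖ ≤ M) (hhe : 1 ≤ inner ℝ h e) (hg : ‖g‖ ≤ N) (hk : ‖k‖ ≤ N)
    (hgk : C * N ^ 2 ≤ inner ℝ g k) (horth : inner ℝ (θ • g + (1 - θ) • k) h = 0) (c : ℝ) :
    C / (2 * (1 + M)) * N ≤ ‖θ • g + (1 - θ) • k - c • e‖ := by
  rcases hN.eq_or_lt with rfl | hN
  · rw [mul_zero]
    exact norm_nonneg _
  have hM0 : 0 ≤ M := (norm_nonneg h).trans hM
  have hgk' : ‖g + k‖ ≤ 2 * N := (norm_add_le g k).trans (by linarith)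
  rw [div_mul_eq_mul_div, div_le_iff₀ (by positivity)]
  refine le_of_mul_le_mul_right ?_ hN
  calc C * N * N = C * N ^ 2 := by ring
    _ ≤ inner ℝ (θ • g + (1 - θ) • k) (g + k) :=
      hgk.trans (inner_le_inner_convexCombination_add hθ g k)
    _ ≤ ‖θ • g + (1 - θ) • k - c • e‖ * (‖g + k‖ * (1 + ‖h‖)) :=
      inner_le_norm_sub_smul_mul he hhe horth _ c
    _ ≤ ‖θ • g + (1 - θ) • k - c • e‖ * (2 * N * (1 + M)) := by gcongr
    _ = ‖θ • g + (1 - θ) • k - c • e‖ * (2 * (1 + M)) * N := by ring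

end InnerProductSpace

theorem inner_toLp_right {α : Type*} {m : MeasurableSpace α} {μ : Measure α} {f : α → ℝ}
    (g : Lp ℝ 2 μ) (hf : MemLp f 2 μ) : inner ℝ g (hf.toLp f) = ∫ x, g x * f x ∂μ := by
  rw [L2.inner_def]
  refine integral_congr_ae ?_
  filter_upwards [hf.coeFn_toLp] with x hx
  rw [hx, real_inner_eq_re_inner, RCLike.inner_apply, conj_trivial, mul_comm, RCLike.re_to_real]

theorem inner_toLp_toLp {α : Type*} {m : MeasurableSpace α} {μ : Measure α} {f g : α → ℝ}
    (hg : MemLp g 2 μ) (hf : MemLp f 2 μ) :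
    inner ℝ (hg.toLp g) (hf.toLp f) = ∫ x, g x * f x ∂μ := by
  rw [inner_toLp_right]
  refine integral_congr_ae ?_
  filter_upwards [hg.coeFn_toLp] with x hx
  rw [hx]

/-- The space `C_0^∞(0,1)`. -/
def testFunctions : Submodule ℝ (ℝ → ℝ) where
  carrier := {φ | IsTestFunction φ}
  zero_mem' := .zero
  add_mem' hφ hψ := hφ.add hψ
  smul_mem' c _ hφ := hφ.smul c

/-- The space `L²(0,1)`. -/
abbrev L2Unit : Type := Lp ℝ 2 (volume.restrict (Ioo (0 : ℝ) 1))

theorem memLp_unit_of_continuous {f : ℝ → ℝ} (hf : Continuous f) :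
    MemLp f 2 (volume.restrict (Ioo (0 : ℝ) 1)) := by
  obtain ⟨B, hB⟩ := isCompact_Icc.exists_bound_of_continuousOn (s := Icc (0 : ℝ) 1)
    hf.continuousOn
  refine MemLp.of_bound hf.aestronglyMeasurable B ?_
  filter_upwards [ae_restrict_mem measurableSet_Ioo] with x hx
  exact hB x (Ioo_subset_Icc_self hx)

namespace IsTestFunction

variable {φ ψ : ℝ → ℝ}

theorem deriv_add (hφ : IsTestFunction φ) (hψ : IsTestFunction ψ) :
    _root_.deriv (φ + ψ) = _root_.deriv φ + _root_.deriv ψ :=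
  funext fun x => _root_.deriv_add (hφ.differentiable x) (hψ.differentiable x)

theorem deriv_smul (c : ℝ) (hφ : IsTestFunction φ) :
    _root_.deriv (c • φ) = c • _root_.deriv φ :=
  funext fun x => deriv_const_smul c (hφ.differentiable x)

theorem conv_add {K : ℝ → ℝ} (hK : Integrable K) (hφ : IsTestFunction φ)
    (hψ : IsTestFunction ψ) : conv K (φ + ψ) = conv K φ + conv K ψ :=
  ConvolutionExists.distrib_add
    (hφ.hasCompactSupport.convolutionExists_right _ hK.locallyIntegrable hφ.continuous)
    (hψ.hasCompactSupport.convolutionExists_right _ hK.locallyIntegrable hψ.continuous)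

end IsTestFunction

/-- The derivative of test functions, with values in `L²(0,1)`. -/
def derivTest : testFunctions →ₗ[ℝ] L2Unit where
  toFun φ := MemLp.toLp (deriv φ.1) (memLp_unit_of_continuous φ.2.deriv.continuous)
  map_add' φ ψ := by
    rw [← MemLp.toLp_add]
    exact MemLp.toLp_congr _ _ (by rw [Submodule.coe_add, φ.2.deriv_add ψ.2])
  map_smul' c φ := by
    rw [RingHom.id_apply, ← MemLp.toLp_const_smul]
    exact MemLp.toLp_congr _ _ (by rw [Submodule.coe_smul, φ.2.deriv_smul])

theorem IsTestFunction.memLp_conv_deriv {K φ : ℝ → ℝ} (hK : Integrable K)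
    (hφ : IsTestFunction φ) :
    MemLp (conv K (_root_.deriv φ)) 2 (volume.restrict (Ioo (0 : ℝ) 1)) :=
  memLp_unit_of_continuous (continuous_conv hK hφ.deriv)

/-- The convolution of a kernel with the derivative of test functions, in `L²(0,1)`. -/
def convTest {K : ℝ → ℝ} (hK : Integrable K) : testFunctions →ₗ[ℝ] L2Unit where
  toFun φ := (φ.2.memLp_conv_deriv hK).toLp
  map_add' φ ψ := by
    rw [← MemLp.toLp_add]
    exact MemLp.toLp_congr _ _ (by
      rw [Submodule.coe_add, φ.2.deriv_add ψ.2, φ.2.deriv.conv_add hK ψ.2.deriv])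
  map_smul' c φ := by
    rw [RingHom.id_apply, ← MemLp.toLp_const_smul]
    exact MemLp.toLp_congr _ _ (EventuallyEq.of_eq (by
      rw [Submodule.coe_smul, φ.2.deriv_smul]
      exact convolution_smul))

theorem inner_convTest_convTest {K L : ℝ → ℝ} (hK : Integrable K) (hL : Integrable L)
    (φ : testFunctions) : inner ℝ (convTest hK φ) (convTest hL φ) =
      ∫ x in Ioo (0 : ℝ) 1, conv K (deriv φ.1) x * conv L (deriv φ.1) x :=
  inner_toLp_toLp (φ.2.memLp_conv_deriv hK) (φ.2.memLp_conv_deriv hL)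

theorem norm_sq_convTest {K : ℝ → ℝ} (hK : Integrable K) (φ : testFunctions) :
    ‖convTest hK φ‖ ^ 2 = ∫ x in Ioo (0 : ℝ) 1, conv K (deriv φ.1) x ^ 2 := by
  rw [← real_inner_self_eq_norm_sq, inner_convTest_convTest]
  simp only [sq]

/-- The constant function `1` in `L²(0,1)`. -/
def oneUnit : L2Unit := (memLp_const 1).toLp fun _ => 1

theorem norm_oneUnit : ‖oneUnit‖ = 1 := by
  refine (Lp.norm_const' 2 (volume.restrict (Ioo (0 : ℝ) 1)) 1 two_ne_zero
    ENNReal.ofNat_ne_top).trans ?_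
  simp

theorem seminormSq_nonneg (μ : ℝ) (φ : ℝ → ℝ) : 0 ≤ seminormSq μ φ :=
  integral_nonneg fun _ => by positivity

section DistanceToConstants

variable {β p q : ℝ}

theorem one_le_betaWeight {x : ℝ} (hp : p ≤ 1) (hq : q ≤ 1) (hx : x ∈ Ioo (0 : ℝ) 1) :
    1 ≤ betaWeight p q x := by
  have hx' := one_sub_mem_Ioo.2 hx
  exact one_le_mul_of_one_le_of_one_le
    (one_le_rpow_of_pos_of_le_one_of_nonpos hx.1 hx.2.le (by linarith))
    (one_le_rpow_of_pos_of_le_one_of_nonpos hx'.1 hx'.2.le (by linarith))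

theorem betaWeight_sq_le {x : ℝ} (hp : 1 - β ≤ p) (hq : 1 - β ≤ q) (hx : x ∈ Ioo (0 : ℝ) 1) :
    betaWeight p q x ^ 2 ≤ betaWeight (1 - 2 * β) (1 - 2 * β) x := by
  have hsq : ∀ y ∈ Ioo (0 : ℝ) 1, ∀ r, 1 - β ≤ r → (y ^ (r - 1)) ^ 2 ≤ y ^ (1 - 2 * β - 1) :=
    fun y hy r hr => by
      rw [← rpow_natCast, ← rpow_mul hy.1.le]
      exact rpow_le_rpow_of_exponent_ge hy.1 hy.2.le (by push_cast; linarith)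
  have hx' := one_sub_mem_Ioo.2 hx
  rw [betaWeight, mul_pow]
  exact mul_le_mul (hsq x hx p hp) (hsq (1 - x) hx' q hq) (sq_nonneg _) (rpow_nonneg hx.1.le _)

theorem memLp_betaWeight (hβ : β < 1 / 2) (hp : 1 - β ≤ p) (hq : 1 - β ≤ q) :
    MemLp (betaWeight p q) 2 (volume.restrict (Ioo (0 : ℝ) 1)) := by
  have hm := measurable_betaWeight p q
  refine (memLp_two_iff_integrable_sq hm.aestronglyMeasurable).2 ?_
  refine Integrable.mono' (integrableOn_betaWeight (p := 1 - 2 * β) (q := 1 - 2 * β)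
    (by linarith) (by linarith)) (hm.pow_const 2).aestronglyMeasurable ?_
  filter_upwards [ae_restrict_mem measurableSet_Ioo] with x hx
  rw [Real.norm_of_nonneg (sq_nonneg _)]
  exact betaWeight_sq_le hp hq hx

theorem norm_toLp_betaWeight_le (hβ : β < 1 / 2) (hp : 1 - β ≤ p) (hq : 1 - β ≤ q) :
    ‖(memLp_betaWeight hβ hp hq).toLp‖ ≤
      √(∫ x in Ioo (0 : ℝ) 1, betaWeight (1 - 2 * β) (1 - 2 * β) x) := by
  refine Real.le_sqrt_of_sq_le ?_
  rw [← real_inner_self_eq_norm_sq, inner_toLp_toLp]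
  simp only [← sq]
  exact setIntegral_mono_on (memLp_betaWeight hβ hp hq).integrable_sq
    (integrableOn_betaWeight (by linarith) (by linarith)) measurableSet_Ioo
    fun x hx => betaWeight_sq_le hp hq hx

theorem one_le_inner_betaWeight_oneUnit (hp : p ≤ 1) (hq : q ≤ 1)
    (h : MemLp (betaWeight p q) 2 (volume.restrict (Ioo (0 : ℝ) 1))) :
    1 ≤ inner ℝ (h.toLp) oneUnit := by
  rw [oneUnit, inner_toLp_toLp]
  simp only [mul_one]
  calc (1 : ℝ) = ∫ _ in Ioo (0 : ℝ) 1, (1 : ℝ) := by simp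
    _ ≤ ∫ x in Ioo (0 : ℝ) 1, betaWeight p q x :=
      setIntegral_mono_on (integrable_const _) (h.integrable one_le_two) measurableSet_Ioo
        fun x hx => one_le_betaWeight hp hq hx

theorem convTest_twoSidedKernel (hβ : 0 < β) (θ : ℝ) (φ : testFunctions) :
    convTest (integrable_twoSidedKernel hβ θ) φ =
      θ • convTest (integrable_intervalKernel hβ) φ +
        (1 - θ) • convTest (integrable_refl (integrable_intervalKernel hβ)) φ := by
  have hK := integrable_intervalKernel hβ
  have hcomb := ((φ.2.memLp_conv_deriv hK).const_smul θ).add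
    ((φ.2.memLp_conv_deriv (integrable_refl hK)).const_smul (1 - θ))
  exact MemLp.toLp_congr (φ.2.memLp_conv_deriv (integrable_twoSidedKernel hβ θ)) hcomb
    (ae_restrict_of_ae (ae_conv_twoSidedKernel hβ φ.2.deriv.integrable θ))

theorem norm_convTest_intervalKernel_le (hβ : 0 < β) (hβ1 : β ≤ 1) (φ : testFunctions) :
    ‖convTest (integrable_intervalKernel hβ) φ‖ ≤ √(seminormSq (1 - β) φ.1) :=
  Real.le_sqrt_of_sq_le
    ((norm_sq_convTest _ φ).trans_le (integral_conv_intervalKernel_sq_le hβ hβ1 φ.2))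

theorem norm_convTest_refl_intervalKernel_le (hβ : 0 < β) (hβ1 : β ≤ 1) (φ : testFunctions) :
    ‖convTest (integrable_refl (integrable_intervalKernel hβ)) φ‖ ≤
      √(seminormSq (1 - β) φ.1) :=
  Real.le_sqrt_of_sq_le
    ((norm_sq_convTest _ φ).trans_le (integral_conv_refl_intervalKernel_sq_le hβ hβ1 φ.2))

theorem norm_convTest_twoSidedKernel_le {θ : ℝ} (hβ : 0 < β) (hβ1 : β ≤ 1)
    (hθ : θ ∈ Icc (0 : ℝ) 1) (φ : testFunctions) :
    ‖convTest (integrable_twoSidedKernel hβ θ) φ‖ ≤ √(seminormSq (1 - β) φ.1) := by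
  have hmem := (convex_closedBall (0 : L2Unit) (√(seminormSq (1 - β) φ.1)))
    (mem_closedBall_zero_iff.2 (norm_convTest_intervalKernel_le hβ hβ1 φ))
    (mem_closedBall_zero_iff.2 (norm_convTest_refl_intervalKernel_le hβ hβ1 φ))
    hθ.1 (sub_nonneg.2 hθ.2) (add_sub_cancel θ 1)
  rw [convTest_twoSidedKernel hβ]
  exact mem_closedBall_zero_iff.1 hmem

/-- The inf-sup constant of the form with respect to the seminorms of `H^{1-β}` and `H^1`. The
cosine measures the angle between the two one-sided fractional derivatives, the integral bounds
the squared norm of the beta weights orthogonal to the range of the two-sided derivatives. -/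
def infSupConst (β : ℝ) : ℝ :=
  cos (π * β) / (2 * (1 + √(∫ x in Ioo (0 : ℝ) 1, betaWeight (1 - 2 * β) (1 - 2 * β) x)))

theorem infSupConst_pos (hβ : 0 < β) (hβ1 : β < 1 / 2) : 0 < infSupConst β :=
  div_pos (cos_pos_of_mem_Ioo ⟨by nlinarith [pi_pos], by nlinarith [pi_pos]⟩) (by positivity)

theorem infSupConst_mul_le_norm_convTest_sub_smul {θ : ℝ} (hβ : 0 < β) (hβ1 : β < 1 / 2)
    (hθ : θ ∈ Icc (0 : ℝ) 1) (φ : testFunctions) (c : ℝ) :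
    infSupConst β * √(seminormSq (1 - β) φ.1) ≤
      ‖convTest (integrable_twoSidedKernel hβ θ) φ - c • oneUnit‖ := by
  obtain ⟨p, hp, q, hq, hpq, hsin⟩ := exists_mul_sin_eq_mul_sin hβ.le (by linarith) hθ
  have hmem := memLp_betaWeight hβ1 hp.1 hq.1
  have hacute : cos (π * β) * √(seminormSq (1 - β) φ.1) ^ 2 ≤
      inner ℝ (convTest (integrable_intervalKernel hβ) φ)
        (convTest (integrable_refl (integrable_intervalKernel hβ)) φ) := by
    rw [Real.sq_sqrt (seminormSq_nonneg _ _), inner_convTest_convTest]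
    exact cos_mul_seminormSq_le_integral_conv_mul_refl hβ (by linarith) φ.2
  have horth : inner ℝ (convTest (integrable_twoSidedKernel hβ θ) φ) hmem.toLp = 0 := by
    have hconv := φ.2.memLp_conv_deriv (integrable_twoSidedKernel hβ θ)
    rw [real_inner_comm]
    exact (inner_toLp_toLp hmem hconv).trans (setIntegral_betaWeight_mul_conv_deriv hβ
      ⟨by linarith [hp.1], hp.2⟩ ⟨by linarith [hq.1], hq.2⟩ hpq hsin φ.2)
  rw [convTest_twoSidedKernel hβ] at horth ⊢
  exact le_norm_convexCombination_sub_smul hθ (Real.sqrt_nonneg _) norm_oneUnit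
    (norm_toLp_betaWeight_le hβ1 hp.1 hq.1) (one_le_inner_betaWeight_oneUnit hp.2 hq.2 hmem)
    (norm_convTest_intervalKernel_le hβ (by linarith) φ)
    (norm_convTest_refl_intervalKernel_le hβ (by linarith) φ) hacute horth c

end DistanceToConstants

namespace IsTestFunction

variable {φ : ℝ → ℝ}

/-- A test function as an element of `L²(ℝ)`. -/
def toL2 (hφ : IsTestFunction φ) : Lp ℝ 2 (volume : Measure ℝ) := hφ.memLp_two.toLp φ

theorem complexify_toL2 (hφ : IsTestFunction φ) :
    complexify hφ.toL2 = hφ.schwartz.toLp 2 volume := by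
  refine Lp.ext ?_
  filter_upwards [ContinuousLinearMap.coeFn_compLpL (p := 2) (μ := volume) Complex.ofRealCLM
    hφ.toL2, hφ.schwartz.coeFn_toLp 2 volume, hφ.memLp_two.coeFn_toLp] with x h1 h2 h3
  rw [h2, complexify, h1, toL2, h3]
  rfl

theorem coeFn_fourierL2 (hφ : IsTestFunction φ) : fourierL2 hφ.toL2 =ᵐ[volume] fhat φ := by
  rw [fourierL2, hφ.complexify_toL2, SchwartzMap.toLp_fourier_eq]
  exact (𝓕 hφ.schwartz : SchwartzMap ℝ ℂ).coeFn_toLp 2 volume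

theorem norm_sq_weightedFourier_ae (hφ : IsTestFunction φ) (μ : ℝ) :
    ∀ᵐ ξ, ‖weightedFourier μ hφ.toL2 ξ‖ ^ 2 = |2 * π * ξ| ^ (2 * μ) * ‖fhat φ ξ‖ ^ 2 := by
  filter_upwards [hφ.coeFn_fourierL2] with ξ hξ
  rw [weightedFourier, hξ, norm_mul, mul_pow, Complex.norm_real,
    Real.norm_of_nonneg (by positivity), ← rpow_mul_natCast (abs_nonneg _), mul_comm μ,
    Nat.cast_ofNat]

theorem memLp_weightedFourier (hφ : IsTestFunction φ) {μ : ℝ} (h0 : 0 ≤ μ) :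
    MemLp (weightedFourier μ hφ.toL2) 2 volume := by
  have hmeas : AEStronglyMeasurable (weightedFourier μ hφ.toL2) volume := by
    refine AEStronglyMeasurable.mul (Continuous.aestronglyMeasurable ?_)
      (Lp.aestronglyMeasurable _)
    refine Complex.continuous_ofReal.comp ?_
    exact (by fun_prop : Continuous fun ξ : ℝ => |2 * π * ξ|).rpow_const fun _ => Or.inr h0
  refine (memLp_two_iff_integrable_sq_norm hmeas).2 ?_
  exact (integrable_congr (hφ.norm_sq_weightedFourier_ae μ)).2
    (hφ.integrable_rpow_mul_norm_fhat_sq (by linarith))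

end IsTestFunction

theorem norm_sq_toLp {α E : Type*} [MeasurableSpace α] [NormedAddCommGroup E] {ν : Measure α}
    {f : α → E} (hf : MemLp f 2 ν) : ‖hf.toLp f‖ ^ 2 = ∫ x, ‖f x‖ ^ 2 ∂ν := by
  rw [Lp.norm_toLp, hf.eLpNorm_eq_integral_rpow_norm two_ne_zero ENNReal.ofNat_ne_top,
    ENNReal.toReal_ofReal (by positivity), ← rpow_natCast, ← rpow_mul (by positivity)]
  simp

section TestEmbedding

/-- The embedding of `C_0^∞(0,1)` into `H^μ_0(0,1)`. -/
def testEmbedding {μ : ℝ} (h0 : 0 ≤ μ) : testFunctions →ₗ[ℝ] SobolevZero μ where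
  toFun φ := ⟨(⟨φ.2.toL2, φ.2.memLp_weightedFourier h0⟩ : ↥(sobolevSubmodule μ)),
    (testSubmodule μ).le_topologicalClosure ⟨φ.1, φ.2, φ.2.memLp_two.coeFn_toLp⟩⟩
  map_add' φ ψ := Subtype.ext (SobolevR.toL2_injective
    (MemLp.toLp_add φ.2.memLp_two ψ.2.memLp_two))
  map_smul' c φ := Subtype.ext (SobolevR.toL2_injective
    (MemLp.toLp_const_smul c φ.2.memLp_two))

variable {μ : ℝ} (h0 : 0 ≤ μ)

theorem toL2_testEmbedding (φ : testFunctions) :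
    SobolevR.toL2 (testEmbedding h0 φ : SobolevR μ) = φ.2.toL2 := rfl

theorem fn_testEmbedding (φ : testFunctions) : (testEmbedding h0 φ).fn =ᵐ[volume] φ.1 :=
  φ.2.memLp_two.coeFn_toLp

theorem norm_sq_testEmbedding (φ : testFunctions) :
    ‖testEmbedding h0 φ‖ ^ 2 = (∫ x, φ.1 x ^ 2) + seminormSq μ φ.1 := by
  have htoL2 : ‖φ.2.toL2‖ ^ 2 = ∫ x, φ.1 x ^ 2 :=
    (norm_sq_toLp φ.2.memLp_two).trans (by simp only [Real.norm_eq_abs, sq_abs])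
  have hweighted : ‖SobolevR.weighted (testEmbedding h0 φ : SobolevR μ)‖ ^ 2 =
      seminormSq μ φ.1 :=
    (norm_sq_toLp (φ.2.memLp_weightedFourier h0)).trans
      (integral_congr_ae (φ.2.norm_sq_weightedFourier_ae μ))
  rw [Submodule.coe_norm, SobolevR.norm_sq_eq, toL2_testEmbedding, htoL2, hweighted]

theorem sqrt_seminormSq_le_norm (φ : testFunctions) :
    √(seminormSq μ φ.1) ≤ ‖testEmbedding h0 φ‖ := by
  refine Real.sqrt_le_iff.2 ⟨norm_nonneg _, ?_⟩
  rw [norm_sq_testEmbedding]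
  exact le_add_of_nonneg_left (integral_nonneg fun _ => sq_nonneg _)

theorem norm_le_two_mul_sqrt_seminormSq (φ : testFunctions) :
    ‖testEmbedding h0 φ‖ ≤ 2 * √(seminormSq μ φ.1) := by
  refine le_of_sq_le_sq ?_ (by positivity)
  rw [mul_pow, Real.sq_sqrt (seminormSq_nonneg _ _), norm_sq_testEmbedding]
  linarith [φ.2.integral_sq_le_seminormSq h0, seminormSq_nonneg μ φ.1]

theorem denseRange_testEmbedding : DenseRange (testEmbedding h0) := by
  intro w
  refine Metric.mem_closure_iff.2 fun ε hε => ?_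
  obtain ⟨z, ⟨φ, hφ, hφz⟩, hwz⟩ := Metric.mem_closure_iff.1 w.2 ε hε
  have hz : (testEmbedding h0 ⟨φ, hφ⟩ : SobolevR μ) = z :=
    SobolevR.toL2_injective (Lp.ext (hφ.memLp_two.coeFn_toLp.trans hφz.symm))
  refine ⟨_, ⟨⟨φ, hφ⟩, rfl⟩, ?_⟩
  rwa [Subtype.dist_eq, hz]

end TestEmbedding

namespace SobolevR

variable {μ : ℝ}

theorem norm_toL2_le (w : SobolevR μ) : ‖toL2 w‖ ≤ ‖w‖ :=
  le_of_sq_le_sq (by rw [norm_sq_eq]; exact le_add_of_nonneg_right (sq_nonneg _)) (norm_nonneg _)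

/-- The continuous inclusion `H^μ(ℝ) ⊆ L²(ℝ)`. -/
def toL2CLM : SobolevR μ →L[ℝ] Lp ℝ 2 (volume : Measure ℝ) :=
  toL2.mkContinuous 1 fun w => by simpa using norm_toL2_le w

theorem coeFn_weighted (w : SobolevR μ) :
    weighted w =ᵐ[volume] weightedFourier μ (toL2 w) := (memLp_weighted w).coeFn_toLp

theorem continuous_fourierL2 : Continuous fourierL2 :=
  (Lp.fourierTransformₗᵢ ℝ ℂ).continuous.comp complexify.continuous

theorem weightedFourier_ae_eq_of_tendsto {u : ℕ → Lp ℝ 2 (volume : Measure ℝ)}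
    {v : ℕ → Lp ℂ 2 (volume : Measure ℝ)} {w : Lp ℝ 2 (volume : Measure ℝ)}
    {z : Lp ℂ 2 (volume : Measure ℝ)} (huv : ∀ n, v n =ᵐ[volume] weightedFourier μ (u n))
    (hu : Tendsto u atTop (𝓝 w)) (hv : Tendsto v atTop (𝓝 z)) :
    weightedFourier μ w =ᵐ[volume] z := by
  have hfourier : Tendsto (fun n => fourierL2 (u n)) atTop (𝓝 (fourierL2 w)) :=
    (continuous_fourierL2.tendsto w).comp hu
  obtain ⟨ns, hns, hu_ae⟩ := (tendstoInMeasure_of_tendsto_Lp hfourier).exists_seq_tendsto_ae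
  obtain ⟨ms, hms, hv_ae⟩ :=
    (tendstoInMeasure_of_tendsto_Lp (hv.comp hns.tendsto_atTop)).exists_seq_tendsto_ae
  filter_upwards [hu_ae, hv_ae, ae_all_iff.2 huv] with ξ huξ hvξ huvξ
  simp only [Function.comp_apply, huvξ, weightedFourier] at hvξ
  exact tendsto_nhds_unique ((huξ.comp hms.tendsto_atTop).const_mul _) hvξ

theorem isClosed_range_graphMap : IsClosed (range (graphMap (μ := μ))) := by
  refine IsSeqClosed.isClosed fun x p hx hxp => ?_
  choose u hu using hx
  obtain rfl : (fun n => graphMap (u n)) = x := funext hu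
  have hxp' := (WithLp.prod_continuous_ofLp 2 _ _).tendsto p |>.comp hxp
  have hfst : Tendsto (fun n => toL2 (u n)) atTop (𝓝 p.fst) :=
    (continuous_fst.tendsto _).comp hxp'
  have hsnd : Tendsto (fun n => weighted (u n)) atTop (𝓝 p.snd) :=
    (continuous_snd.tendsto _).comp hxp'
  have hp := weightedFourier_ae_eq_of_tendsto (fun n => coeFn_weighted (u n)) hfst hsnd
  have hmem : MemLp (weightedFourier μ p.fst) 2 volume := (memLp_congr_ae hp).2 (Lp.memLp _)
  refine ⟨(⟨p.fst, hmem⟩ : ↥(sobolevSubmodule μ)), ?_⟩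
  exact congrArg (WithLp.toLp 2) (Prod.ext rfl (Lp.ext (hmem.coeFn_toLp.trans hp)))

instance : CompleteSpace (SobolevR μ) :=
  (completeSpace_iff_isComplete_range
    (AddMonoidHomClass.isometry_of_norm (graphMap (μ := μ)) fun _ => rfl).isUniformInducing).2
    isClosed_range_graphMap.isComplete

end SobolevR

instance (μ : ℝ) : CompleteSpace (SobolevZero μ) :=
  (Submodule.isClosed_topologicalClosure _).completeSpace_coe

/-- The restriction of elements of `H^μ_0(0,1)` to the unit interval. -/
def restrictUnit (μ : ℝ) : SobolevZero μ →L[ℝ] L2Unit :=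
  (LpToLpRestrictCLM ℝ ℝ ℝ volume 2 (Ioo (0 : ℝ) 1)).comp
    (SobolevR.toL2CLM.comp (testSubmodule μ).topologicalClosure.subtypeL)

theorem coeFn_restrictUnit {μ : ℝ} (w : SobolevZero μ) :
    restrictUnit μ w =ᵐ[volume.restrict (Ioo (0 : ℝ) 1)] w.fn :=
  LpToLpRestrictCLM_coeFn ℝ (Ioo (0 : ℝ) 1) (SobolevR.toL2 (w : SobolevR μ))

theorem memLp_fn {μ : ℝ} (w : SobolevZero μ) : MemLp w.fn 2 volume :=
  Lp.memLp (SobolevR.toL2 (w : SobolevR μ))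

theorem sq_integral_mul_le {α : Type*} [MeasurableSpace α] {μ : Measure α} {K g : α → ℝ}
    (hK : Integrable K μ) (hKg : Integrable (fun x => K x * g x) μ)
    (hKg2 : Integrable (fun x => |K x| * g x ^ 2) μ) :
    (∫ x, K x * g x ∂μ) ^ 2 ≤ (∫ x, |K x| ∂μ) * ∫ x, |K x| * g x ^ 2 ∂μ := by
  have hquad (t : ℝ) : 0 ≤ (∫ x, |K x| ∂μ) * (t * t) + (-2 * ∫ x, K x * g x ∂μ) * t +
      ∫ x, |K x| * g x ^ 2 ∂μ := by
    have hlin : Integrable (fun x => -2 * (K x * g x) * t) μ := (hKg.const_mul _).mul_const t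
    have hsq : Integrable (fun x => |K x| * (t * t)) μ := hK.abs.mul_const _
    have hadd : Integrable (fun x => |K x| * (t * t) + -2 * (K x * g x) * t) μ := hsq.add hlin
    rw [← integral_mul_const, ← integral_const_mul, ← integral_mul_const,
      ← integral_add hsq hlin, ← integral_add hadd hKg2]
    refine integral_nonneg fun x => ?_
    rcases abs_cases (K x) with ⟨h, hx⟩ | ⟨h, hx⟩
    · calc 0 ≤ K x * (t - g x) ^ 2 := mul_nonneg hx (sq_nonneg _)
        _ = _ := by rw [h]; ring
    · calc 0 ≤ -K x * (t + g x) ^ 2 := mul_nonneg (by linarith) (sq_nonneg _)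
        _ = _ := by rw [h]; ring
  have hdiscrim := discrim_le_zero hquad
  rw [discrim] at hdiscrim
  linarith

theorem memLp_conv {K f : ℝ → ℝ} (hK : Integrable K) (hf : MemLp f 2 volume) :
    MemLp (conv K f) 2 volume := by
  have hmeas : AEStronglyMeasurable (conv K f) volume :=
    (hK.aestronglyMeasurable.convolution_integrand (ContinuousLinearMap.mul ℝ ℝ)
      hf.aestronglyMeasurable).integral_prod_right'
  refine (memLp_two_iff_integrable_sq hmeas).2 ?_
  have hsq := hf.integrable_sq
  refine ((hK.abs.integrable_convolution (ContinuousLinearMap.mul ℝ ℝ) hsq).const_mul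
    (∫ t, |K t|)).mono' (hmeas.pow 2) ?_
  filter_upwards [hK.abs.ae_convolution_exists (ContinuousLinearMap.mul ℝ ℝ) hsq] with x hx
  have hKf2 : Integrable fun t => |K t| * f (x - t) ^ 2 := hx
  have hKf : Integrable fun t => K t * f (x - t) := by
    refine (hK.abs.add hKf2).mono' (hK.aestronglyMeasurable.convolution_integrand_snd
      (ContinuousLinearMap.mul ℝ ℝ) hf.aestronglyMeasurable x) (Eventually.of_forall fun t => ?_)
    calc ‖K t * f (x - t)‖ = |K t| * |f (x - t)| := by rw [Real.norm_eq_abs, abs_mul]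
      _ ≤ |K t| * (1 + f (x - t) ^ 2) := by
        gcongr
        rw [← sq_abs (f (x - t))]
        nlinarith [sq_nonneg (|f (x - t)| - 1), abs_nonneg (f (x - t))]
      _ = |K t| + |K t| * f (x - t) ^ 2 := by ring
  rw [Real.norm_of_nonneg (sq_nonneg _)]
  exact sq_integral_mul_le hK hKf hKf2

theorem IsTestFunction.integrableOn_mul {g φ : ℝ → ℝ} (hφ : IsTestFunction φ)
    (hg : LocallyIntegrableOn g (Ioo 0 1)) : IntegrableOn (fun x => g x * φ x) (Ioo 0 1) := by
  obtain ⟨B, hB⟩ := hφ.exists_abs_le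
  have hsupport : IntegrableOn (fun x => g x * φ x) (tsupport φ) :=
    (hg.integrableOn_compact_subset hφ.tsupport_subset hφ.hasCompactSupport).mul_bdd
      hφ.continuous.aestronglyMeasurable (Eventually.of_forall hB)
  refine ((integrableOn_iff_integrable_of_support_subset ?_).1 hsupport).integrableOn
  exact (Function.support_mul_subset_right _ _).trans subset_closure

theorem HasWeakDeriv.ae_eq {u g g' : ℝ → ℝ} (h : HasWeakDeriv u g) (h' : HasWeakDeriv u g') :
    g =ᵐ[volume.restrict (Ioo (0 : ℝ) 1)] g' := by
  have horth (φ : ℝ → ℝ) (hφ : IsTestFunction φ) : ∫ x, φ x • (g - g') x = 0 :=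
    calc ∫ x, φ x • (g - g') x = ∫ x in Ioo (0 : ℝ) 1, φ x • (g - g') x :=
          (hφ.setIntegral_eq fun x hx => by rw [hx, zero_smul]).symm
      _ = ∫ x in Ioo (0 : ℝ) 1, (g x * φ x - g' x * φ x) := by
          congr 1 with x
          rw [Pi.sub_apply, smul_eq_mul]
          ring
      _ = 0 := by
          rw [integral_sub (hφ.integrableOn_mul h.2.1) (hφ.integrableOn_mul h'.2.1)]
          linarith [h.2.2 φ hφ, h'.2.2 φ hφ]
  have hzero := isOpen_Ioo.ae_eq_zero_of_integral_contDiff_smul_eq_zero (μ := volume)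
    (h.2.1.sub h'.2.1) fun φ hsmooth hcompact hsub => horth φ ⟨hsmooth, hcompact, hsub⟩
  rw [Filter.EventuallyEq, ae_restrict_iff' measurableSet_Ioo]
  filter_upwards [hzero] with x hx hxI
  exact sub_eq_zero.1 (hx hxI)

theorem HasWeakDeriv.weakDeriv_ae {u g : ℝ → ℝ} (h : HasWeakDeriv u g) :
    weakDeriv u =ᵐ[volume.restrict (Ioo (0 : ℝ) 1)] g := by
  have hex : ∃ g, HasWeakDeriv u g := ⟨g, h⟩
  rw [weakDeriv, dif_pos hex]
  exact hex.choose_spec.ae_eq h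

theorem locallyIntegrableOn_of_memLp {f : ℝ → ℝ}
    (hf : MemLp f 2 (volume.restrict (Ioo (0 : ℝ) 1))) : LocallyIntegrableOn f (Ioo 0 1) :=
  IntegrableOn.locallyIntegrableOn (hf.integrable one_le_two)

theorem IsTestFunction.integral_mul_deriv {φ u u' : ℝ → ℝ} (hφ : IsTestFunction φ)
    (hu : ∀ x, HasDerivAt u (u' x) x) (hu' : Continuous u') :
    ∫ x in Ioo (0 : ℝ) 1, u x * _root_.deriv φ x = -∫ x in Ioo (0 : ℝ) 1, u' x * φ x := by
  have huc : Continuous u := continuous_iff_continuousAt.2 fun x => (hu x).continuousAt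
  have hint {a b : ℝ → ℝ} (ha : Continuous a) (hb : IsTestFunction b) : Integrable (a * b) :=
    (ha.mul hb.continuous).integrable_of_hasCompactSupport hb.hasCompactSupport.mul_left
  rw [hφ.deriv.setIntegral_eq fun x hx => by rw [hx, mul_zero],
    hφ.setIntegral_eq fun x hx => by rw [hx, mul_zero]]
  exact integral_mul_deriv_eq_deriv_mul_of_integrable (fun x _ => hu x)
    (fun x _ => (hφ.differentiable x).hasDerivAt) (hint huc hφ.deriv) (hint hu' hφ)
    (hint huc hφ)

section Extension

variable {μ : ℝ}

/-- The extension of an operator on test functions to `H^μ_0(0,1)`. It is a genuine extension as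
soon as the operator is bounded by the seminorm of `H^μ`; otherwise its value is junk. -/
def extendTest (T : testFunctions →ₗ[ℝ] L2Unit) (h0 : 0 ≤ μ) : SobolevZero μ →L[ℝ] L2Unit :=
  T.extendOfNorm (testEmbedding h0)

variable {T : testFunctions →ₗ[ℝ] L2Unit} (h0 : 0 ≤ μ)
  (hT : ∀ φ, ‖T φ‖ ≤ √(seminormSq μ φ.1))

include hT

theorem norm_le_one_mul_norm_testEmbedding (φ : testFunctions) :
    ‖T φ‖ ≤ 1 * ‖testEmbedding h0 φ‖ := by
  rw [one_mul]
  exact (hT φ).trans (sqrt_seminormSq_le_norm h0 φ)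

theorem extendTest_testEmbedding (φ : testFunctions) :
    extendTest T h0 (testEmbedding h0 φ) = T φ :=
  LinearMap.extendOfNorm_eq (denseRange_testEmbedding h0)
    ⟨1, norm_le_one_mul_norm_testEmbedding h0 hT⟩ φ

theorem norm_extendTest_le (w : SobolevZero μ) : ‖extendTest T h0 w‖ ≤ ‖w‖ := by
  simpa only [extendTest, one_mul] using LinearMap.norm_extendOfNorm_apply_le
    (denseRange_testEmbedding h0) 1 (norm_le_one_mul_norm_testEmbedding h0 hT) w

theorem inner_restrictUnit_eq_neg_inner_extendTest {g h : L2Unit}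
    (hgh : ∀ φ : testFunctions, ∫ x in Ioo (0 : ℝ) 1, g x * φ.1 x = -inner ℝ h (T φ))
    (w : SobolevZero μ) :
    inner ℝ (restrictUnit μ w) g = -inner ℝ (extendTest T h0 w) h := by
  refine (denseRange_testEmbedding h0).induction_on
    (p := fun w => inner ℝ (restrictUnit μ w) g = -inner ℝ (extendTest T h0 w) h) w
    (isClosed_eq (by fun_prop) (by fun_prop)) fun φ => ?_
  have hmem := memLp_unit_of_continuous φ.2.continuous
  have hfn : (testEmbedding h0 φ).fn =ᵐ[volume.restrict (Ioo 0 1)] φ.1 :=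
    ae_restrict_of_ae (fn_testEmbedding h0 φ)
  have hφ : restrictUnit μ (testEmbedding h0 φ) = hmem.toLp :=
    Lp.ext ((coeFn_restrictUnit _).trans (hfn.trans hmem.coeFn_toLp.symm))
  rw [extendTest_testEmbedding h0 hT, hφ, real_inner_comm, inner_toLp_right, hgh,
    real_inner_comm]

end Extension

theorem setIntegral_fn_mul {μ : ℝ} (w : SobolevZero μ) {f : ℝ → ℝ}
    (hf : MemLp f 2 (volume.restrict (Ioo (0 : ℝ) 1))) :
    ∫ x in Ioo (0 : ℝ) 1, w.fn x * f x = inner ℝ (restrictUnit μ w) hf.toLp := by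
  rw [inner_toLp_right]
  refine integral_congr_ae ?_
  filter_upwards [coeFn_restrictUnit w] with x hx
  rw [hx]

section Derivative

theorem norm_derivTest (φ : testFunctions) : ‖derivTest φ‖ = √(seminormSq 1 φ.1) := by
  have hsq : ‖derivTest φ‖ ^ 2 = seminormSq 1 φ.1 := by
    refine (norm_sq_toLp (memLp_unit_of_continuous φ.2.deriv.continuous)).trans ?_
    simp only [Real.norm_eq_abs, sq_abs]
    rw [φ.2.deriv.setIntegral_eq fun x hx => by rw [hx, zero_pow two_ne_zero],
      φ.2.deriv.integral_sq_eq_fhat, seminormSq]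
    simp only [φ.2.norm_fhat_deriv_sq, mul_one, rpow_two]
  rw [← hsq, Real.sqrt_sq (norm_nonneg _)]

/-- The weak derivative as a continuous operator on `H^1_0(0,1)`. -/
def derivCLM : SobolevZero 1 →L[ℝ] L2Unit := extendTest derivTest zero_le_one

theorem derivCLM_testEmbedding (φ : testFunctions) :
    derivCLM (testEmbedding zero_le_one φ) = derivTest φ :=
  extendTest_testEmbedding zero_le_one (fun φ => (norm_derivTest φ).le) φ

theorem norm_derivCLM_le (v : SobolevZero 1) : ‖derivCLM v‖ ≤ ‖v‖ :=
  norm_extendTest_le zero_le_one (fun φ => (norm_derivTest φ).le) v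

theorem norm_le_two_mul_norm_derivCLM (v : SobolevZero 1) : ‖v‖ ≤ 2 * ‖derivCLM v‖ := by
  refine (denseRange_testEmbedding zero_le_one).induction_on
    (p := fun v => ‖v‖ ≤ 2 * ‖derivCLM v‖) v (isClosed_le (by fun_prop) (by fun_prop)) fun φ => ?_
  rw [derivCLM_testEmbedding, norm_derivTest]
  exact norm_le_two_mul_sqrt_seminormSq zero_le_one φ

theorem hasWeakDeriv_derivCLM (v : SobolevZero 1) : HasWeakDeriv v.fn (derivCLM v) := by
  refine ⟨locallyIntegrableOn_of_memLp ((memLp_fn v).restrict _),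
    locallyIntegrableOn_of_memLp (Lp.memLp _), fun ψ hψ => ?_⟩
  have hψ_mem := memLp_unit_of_continuous hψ.continuous
  have hψ'_mem := memLp_unit_of_continuous hψ.deriv.continuous
  rw [setIntegral_fn_mul v hψ'_mem, ← inner_toLp_right _ hψ_mem]
  refine inner_restrictUnit_eq_neg_inner_extendTest zero_le_one
    (fun φ => (norm_derivTest φ).le) (fun φ => ?_) v
  calc ∫ x in Ioo (0 : ℝ) 1, hψ'_mem.toLp _ x * φ.1 x
      = ∫ x in Ioo (0 : ℝ) 1, φ.1 x * deriv ψ x := by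
        refine integral_congr_ae ?_
        filter_upwards [hψ'_mem.coeFn_toLp] with x hx
        rw [hx, mul_comm]
    _ = -∫ x in Ioo (0 : ℝ) 1, deriv φ.1 x * ψ x :=
        hψ.integral_mul_deriv (fun x => (φ.2.differentiable x).hasDerivAt) φ.2.deriv.continuous
    _ = -inner ℝ (hψ_mem.toLp ψ) (derivTest φ) := by
        rw [real_inner_comm]
        exact congrArg Neg.neg (inner_toLp_toLp
          (memLp_unit_of_continuous φ.2.deriv.continuous) hψ_mem).symm

theorem memSobolevOne_fn (v : SobolevZero 1) : MemSobolevOne v.fn :=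
  ⟨(memLp_fn v).restrict _, _, hasWeakDeriv_derivCLM v, Lp.memLp _⟩

end Derivative

theorem hasDerivAt_conv {K φ : ℝ → ℝ} (hK : Integrable K) (hφ : IsTestFunction φ) (x : ℝ) :
    HasDerivAt (conv K φ) (conv K (deriv φ) x) x :=
  hφ.hasCompactSupport.hasDerivAt_convolution_right (ContinuousLinearMap.mul ℝ ℝ)
    hK.locallyIntegrable (hφ.smooth.of_le (by simp)) x

theorem IsTestFunction.setIntegral_mul_conv_refl_deriv {K φ ψ : ℝ → ℝ} (hK : Integrable K)
    (hφ : IsTestFunction φ) (hψ : IsTestFunction ψ) :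
    ∫ x in Ioo (0 : ℝ) 1, φ x * conv (refl K) (_root_.deriv ψ) x =
      -∫ x in Ioo (0 : ℝ) 1, conv K (_root_.deriv φ) x * ψ x := by
  have hind : (Ioo (0 : ℝ) 1).indicator φ = φ :=
    Set.indicator_eq_self.2 ((subset_tsupport φ).trans hφ.tsupport_subset)
  rw [← hψ.deriv.setIntegral_conv_mul hK hφ.integrable.integrableOn, hind]
  exact hψ.integral_mul_deriv (hasDerivAt_conv hK hφ) (continuous_conv hK hφ.deriv)

theorem integrableOn_fn {μ : ℝ} (w : SobolevZero μ) : IntegrableOn w.fn (Ioo 0 1) :=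
  ((memLp_fn w).restrict _).integrable one_le_two

section FractionalOperator

variable {β θ : ℝ}

theorem memLp_twoSidedFracInt {μ : ℝ} (hβ : 0 < β) (θ : ℝ) (w : SobolevZero μ) :
    MemLp (twoSidedFracInt β θ w.fn) 2 (volume.restrict (Ioo 0 1)) :=
  (memLp_congr_ae (twoSidedFracInt_ae_eq_conv hβ (integrableOn_fn w) θ)).2
    ((memLp_conv (integrable_twoSidedKernel hβ θ)
      ((memLp_fn w).indicator measurableSet_Ioo)).restrict _)

/-- The operator `w ↦ D I^β_θ w` from `H^{1-β}_0(0,1)` to `L²(0,1)`. -/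
def fracCLM (hβ : 0 < β) (hβ1 : β ≤ 1) (θ : ℝ) : SobolevZero (1 - β) →L[ℝ] L2Unit :=
  extendTest (convTest (integrable_twoSidedKernel hβ θ)) (sub_nonneg.2 hβ1)

variable (hβ : 0 < β) (hβ1 : β ≤ 1) (hθ : θ ∈ Icc (0 : ℝ) 1)

include hθ

theorem fracCLM_testEmbedding (φ : testFunctions) :
    fracCLM hβ hβ1 θ (testEmbedding (sub_nonneg.2 hβ1) φ) =
      convTest (integrable_twoSidedKernel hβ θ) φ :=
  extendTest_testEmbedding _ (norm_convTest_twoSidedKernel_le hβ hβ1 hθ) φ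

theorem norm_fracCLM_le (w : SobolevZero (1 - β)) : ‖fracCLM hβ hβ1 θ w‖ ≤ ‖w‖ :=
  norm_extendTest_le _ (norm_convTest_twoSidedKernel_le hβ hβ1 hθ) w

theorem hasWeakDeriv_fracCLM (w : SobolevZero (1 - β)) :
    HasWeakDeriv (twoSidedFracInt β θ w.fn) (fracCLM hβ hβ1 θ w) := by
  refine ⟨locallyIntegrableOn_of_memLp (memLp_twoSidedFracInt hβ θ w),
    locallyIntegrableOn_of_memLp (Lp.memLp _), fun ψ hψ => ?_⟩
  have hK := integrable_twoSidedKernel hβ θ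
  have hψ_mem := memLp_unit_of_continuous hψ.continuous
  have hconv_mem := hψ.memLp_conv_deriv (integrable_refl hK)
  calc ∫ x in Ioo (0 : ℝ) 1, twoSidedFracInt β θ w.fn x * deriv ψ x
      = ∫ x in Ioo (0 : ℝ) 1,
          conv (twoSidedKernel β θ) ((Ioo (0 : ℝ) 1).indicator w.fn) x * deriv ψ x := by
        refine integral_congr_ae ?_
        filter_upwards [twoSidedFracInt_ae_eq_conv hβ (integrableOn_fn w) θ] with x hx
        rw [hx]
    _ = inner ℝ (restrictUnit (1 - β) w) hconv_mem.toLp := by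
        rw [hψ.deriv.setIntegral_conv_mul hK (integrableOn_fn w), setIntegral_fn_mul w hconv_mem]
    _ = -inner ℝ (fracCLM hβ hβ1 θ w) hψ_mem.toLp := by
        refine inner_restrictUnit_eq_neg_inner_extendTest (sub_nonneg.2 hβ1)
          (norm_convTest_twoSidedKernel_le hβ hβ1 hθ) (fun φ => ?_) w
        rw [real_inner_comm]
        refine Eq.trans ?_ ((φ.2.setIntegral_mul_conv_refl_deriv hK hψ).trans
          (congrArg Neg.neg (inner_toLp_toLp (φ.2.memLp_conv_deriv hK) hψ_mem).symm))
        refine integral_congr_ae ?_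
        filter_upwards [hconv_mem.coeFn_toLp] with x hx
        rw [hx, mul_comm]
    _ = -∫ x in Ioo (0 : ℝ) 1, fracCLM hβ hβ1 θ w x * ψ x := by rw [inner_toLp_right]

include hβ hβ1 in
theorem memSobolevOne_twoSidedFracInt (w : SobolevZero (1 - β)) :
    MemSobolevOne (twoSidedFracInt β θ w.fn) :=
  ⟨memLp_twoSidedFracInt hβ θ w, _, hasWeakDeriv_fracCLM hβ hβ1 hθ w, Lp.memLp _⟩

theorem pgForm_eq_inner (w : SobolevZero (1 - β)) (v : SobolevZero 1) :
    pgForm β θ w v = inner ℝ (fracCLM hβ hβ1 θ w) (derivCLM v) := by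
  rw [pgForm, L2.inner_def]
  refine integral_congr_ae ?_
  filter_upwards [(hasWeakDeriv_fracCLM hβ hβ1 hθ w).weakDeriv_ae,
    (hasWeakDeriv_derivCLM v).weakDeriv_ae] with x hw hv
  rw [hw, hv, real_inner_eq_re_inner, RCLike.inner_apply', conj_trivial, RCLike.re_to_real]

include hβ hβ1 in
theorem exists_bilin_eq_pgForm :
    ∃ A : SobolevZero (1 - β) →ₗ[ℝ] SobolevZero 1 →ₗ[ℝ] ℝ, ∀ w v, A w v = pgForm β θ w v :=
  ⟨(innerₗ L2Unit).compl₁₂ (fracCLM hβ hβ1 θ).toLinearMap derivCLM.toLinearMap,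
    fun w v => (pgForm_eq_inner hβ hβ1 hθ w v).symm⟩

include hβ hβ1 in
theorem abs_pgForm_le (w : SobolevZero (1 - β)) (v : SobolevZero 1) :
    |pgForm β θ w v| ≤ ‖w‖ * ‖v‖ := by
  rw [pgForm_eq_inner hβ hβ1 hθ]
  exact (abs_real_inner_le_norm _ _).trans (mul_le_mul (norm_fracCLM_le hβ hβ1 hθ w)
    (norm_derivCLM_le v) (norm_nonneg _) (norm_nonneg _))

end FractionalOperator

section DuBoisReymond

theorem IsTestFunction.exists_tsupport_subset_Icc {φ : ℝ → ℝ} (hφ : IsTestFunction φ) :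
    ∃ a b, 0 < a ∧ b < 1 ∧ tsupport φ ⊆ Icc a b := by
  have hcompact : IsCompact (insert (1 / 2 : ℝ) (tsupport φ)) := hφ.hasCompactSupport.insert _
  have hsub : insert (1 / 2 : ℝ) (tsupport φ) ⊆ Ioo 0 1 :=
    insert_subset (by norm_num) hφ.tsupport_subset
  obtain ⟨a, ha⟩ := hcompact.exists_isLeast (insert_nonempty _ _)
  obtain ⟨b, hb⟩ := hcompact.exists_isGreatest (insert_nonempty _ _)
  exact ⟨a, b, (hsub ha.1).1, (hsub hb.1).2,
    fun x hx => ⟨ha.2 (mem_insert_of_mem _ hx), hb.2 (mem_insert_of_mem _ hx)⟩⟩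

theorem integral_zero_eq_zero_of_support_subset_Icc {χ : ℝ → ℝ} {a b x : ℝ} (ha : 0 < a)
    (hχ : Function.support χ ⊆ Icc a b) (hint : ∫ t, χ t = 0) (hx : x ∉ Icc a b) :
    ∫ t in (0 : ℝ)..x, χ t = 0 := by
  rcases lt_or_ge x a with hxa | hxa
  · refine intervalIntegral.integral_zero_ae (Eventually.of_forall fun t ht => ?_)
    exact Function.notMem_support.1 fun hsupp =>
      (hχ hsupp).1.not_gt (ht.2.trans_lt (max_lt ha hxa))
  · have hbx : b < x := not_le.1 fun hxb => hx ⟨hxa, hxb⟩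
    exact (intervalIntegral.integral_eq_integral_of_support_subset fun t ht =>
      ⟨ha.trans_le (hχ ht).1, (hχ ht).2.trans hbx.le⟩).trans hint

theorem IsTestFunction.exists_primitive {χ : ℝ → ℝ} (hχ : IsTestFunction χ)
    (hint : ∫ x, χ x = 0) : ∃ φ, IsTestFunction φ ∧ _root_.deriv φ = χ := by
  obtain ⟨a, b, ha, hb, hab⟩ := hχ.exists_tsupport_subset_Icc
  set φ : ℝ → ℝ := fun x => ∫ t in (0 : ℝ)..x, χ t
  have hφ_deriv (x : ℝ) : HasDerivAt φ (χ x) x :=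
    intervalIntegral.integral_hasDerivAt_right (hχ.continuous.intervalIntegrable _ _)
      (hχ.continuous.stronglyMeasurableAtFilter _ _) hχ.continuous.continuousAt
  have hderiv : _root_.deriv φ = χ := funext fun x => (hφ_deriv x).deriv
  have htsupport : tsupport φ ⊆ Icc a b := by
    refine closure_minimal (fun x hx => not_not.1 fun hxab => hx ?_) isClosed_Icc
    exact integral_zero_eq_zero_of_support_subset_Icc ha ((subset_tsupport χ).trans hab) hint hxab
  refine ⟨φ, ⟨contDiff_infty_iff_deriv.2 ⟨fun x => (hφ_deriv x).differentiableAt, ?_⟩,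
    HasCompactSupport.of_support_subset_isCompact isCompact_Icc
      ((subset_tsupport φ).trans htsupport), htsupport.trans (Icc_subset_Ioo ha hb)⟩, hderiv⟩
  rw [hderiv]
  exact hχ.smooth

theorem exists_isTestFunction_integral_eq_one : ∃ η, IsTestFunction η ∧ ∫ x, η x = 1 := by
  let η : ContDiffBump (1 / 2 : ℝ) := ⟨1 / 8, 1 / 4, by norm_num, by norm_num⟩
  refine ⟨η.normed volume, ⟨η.contDiff_normed, η.hasCompactSupport_normed, ?_⟩, η.integral_normed⟩
  rw [η.tsupport_normed_eq, Real.closedBall_eq_Icc]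
  exact Icc_subset_Ioo (by norm_num [η]) (by norm_num [η])

theorem integrableOn_coeFn_mul (r : L2Unit) {ψ : ℝ → ℝ} (hψ : IsTestFunction ψ) :
    IntegrableOn (fun x => r x * ψ x) (Ioo 0 1) :=
  hψ.integrableOn_mul (locallyIntegrableOn_of_memLp (Lp.memLp r))

theorem setIntegral_mul_deriv_eq_inner_derivTest (r : L2Unit) (φ : testFunctions) :
    ∫ x in Ioo (0 : ℝ) 1, r x * deriv φ.1 x = inner ℝ r (derivTest φ) :=
  (inner_toLp_right r (memLp_unit_of_continuous φ.2.deriv.continuous)).symm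

theorem exists_setIntegral_mul_eq_mul_integral {r : L2Unit}
    (hr : ∀ φ, inner ℝ r (derivTest φ) = 0) :
    ∃ c : ℝ, ∀ ψ, IsTestFunction ψ → ∫ x in Ioo (0 : ℝ) 1, r x * ψ x = c * ∫ x, ψ x := by
  obtain ⟨η, hη, hη_one⟩ := exists_isTestFunction_integral_eq_one
  refine ⟨∫ x in Ioo (0 : ℝ) 1, r x * η x, fun ψ hψ => ?_⟩
  have hmean : ∫ x, (ψ + (-∫ x, ψ x) • η) x = 0 := by
    simp only [Pi.add_apply, Pi.smul_apply, smul_eq_mul]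
    rw [integral_add hψ.integrable (hη.integrable.const_mul _), integral_const_mul, hη_one]
    ring
  obtain ⟨φ, hφ, hderiv⟩ := (hψ.add (hη.smul _)).exists_primitive hmean
  have horth : ∫ x in Ioo (0 : ℝ) 1, (r x * ψ x + (-∫ x, ψ x) * (r x * η x)) = 0 := by
    refine Eq.trans ?_ ((setIntegral_mul_deriv_eq_inner_derivTest r ⟨φ, hφ⟩).trans (hr _))
    congr 1 with x
    simp only [hderiv, Pi.add_apply, Pi.smul_apply, smul_eq_mul]
    ring
  rw [integral_add (integrableOn_coeFn_mul r hψ) ((integrableOn_coeFn_mul r hη).const_mul _),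
    integral_const_mul] at horth
  linarith

theorem exists_eq_smul_oneUnit {r : L2Unit} (hr : ∀ φ, inner ℝ r (derivTest φ) = 0) :
    ∃ c : ℝ, r = c • oneUnit := by
  obtain ⟨c, hc⟩ := exists_setIntegral_mul_eq_mul_integral hr
  have horth (ψ : ℝ → ℝ) (hψ : IsTestFunction ψ) : ∫ x, ψ x • (r x - c) = 0 :=
    calc ∫ x, ψ x • (r x - c) = ∫ x in Ioo (0 : ℝ) 1, ψ x • (r x - c) :=
          (hψ.setIntegral_eq fun x hx => by rw [hx, zero_smul]).symm
      _ = ∫ x in Ioo (0 : ℝ) 1, (r x * ψ x - c * ψ x) := by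
          congr 1 with x
          rw [smul_eq_mul]
          ring
      _ = 0 := by
          rw [integral_sub (integrableOn_coeFn_mul r hψ) (hψ.integrable.restrict.const_mul c),
            hc ψ hψ, integral_const_mul, hψ.setIntegral_eq fun x hx => hx, sub_self]
  have hzero := isOpen_Ioo.ae_eq_zero_of_integral_contDiff_smul_eq_zero (U := Ioo (0 : ℝ) 1)
    (μ := volume) ((locallyIntegrableOn_of_memLp (Lp.memLp r)).sub
      (continuous_const.locallyIntegrable.locallyIntegrableOn _))
    fun ψ hsmooth hcompact hsub => horth ψ ⟨hsmooth, hcompact, hsub⟩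
  rw [← ae_restrict_iff' measurableSet_Ioo] at hzero
  refine ⟨c, Lp.ext ?_⟩
  filter_upwards [hzero, Lp.coeFn_smul c oneUnit, (memLp_const (1 : ℝ)).coeFn_toLp]
    with x hx hsmul hone
  rw [hsmul, Pi.smul_apply, oneUnit, hone, smul_eq_mul, mul_one]
  exact sub_eq_zero.1 hx

end DuBoisReymond

section InfSup

variable {X V Y Z : Type*} [NormedAddCommGroup X] [NormedSpace ℝ X]
  [NormedAddCommGroup V] [NormedSpace ℝ V]
  [NormedAddCommGroup Y] [InnerProductSpace ℝ Y]
  [NormedAddCommGroup Z] [NormedSpace ℝ Z]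
  {T : V →L[ℝ] Z} {G : X →L[ℝ] Y} {D : V →L[ℝ] Y} {c d : ℝ}

theorem isComplete_range_of_bound [CompleteSpace V] (hT : ∀ v, ‖v‖ ≤ d * ‖T v‖) :
    IsComplete (range T) :=
  (AddMonoidHomClass.antilipschitz_of_bound T (K := d.toNNReal) fun v => (hT v).trans
    (mul_le_mul_of_nonneg_right (le_coe_toNNReal d) (norm_nonneg _))).isComplete_range
      T.uniformContinuous

theorem completeSpace_range_of_bound [CompleteSpace V] (hT : ∀ v, ‖v‖ ≤ d * ‖T v‖) :
    CompleteSpace T.range := by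
  have hcomplete : IsComplete (T.range : Set Z) := by
    rw [LinearMap.coe_range]
    exact isComplete_range_of_bound hT
  exact hcomplete.completeSpace_coe

theorem injective_of_bound (hT : ∀ v, ‖v‖ ≤ d * ‖T v‖) : Function.Injective T :=
  (injective_iff_map_eq_zero T).2 fun v hv =>
    norm_le_zero_iff.1 ((hT v).trans_eq (by rw [hv, norm_zero, mul_zero]))

theorem exists_ne_zero_mul_norm_le_inner [CompleteSpace V] (hd : 0 < d)
    (hD : ∀ v, ‖v‖ ≤ d * ‖D v‖) (hc : 0 < c)
    (hG : ∀ w y, (∀ v, inner ℝ y (D v) = 0) → c * ‖w‖ ≤ ‖G w - y‖) {w : X} (hw : w ≠ 0) :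
    ∃ v ≠ 0, c / d * ‖w‖ * ‖v‖ ≤ inner ℝ (G w) (D v) := by
  have := completeSpace_range_of_bound hD
  obtain ⟨v, hv⟩ : ∃ v, D v = D.range.starProjection (G w) :=
    D.range.starProjection_apply_mem (G w)
  have horth (v' : V) : inner ℝ (G w - D v) (D v') = 0 := by
    rw [hv]
    exact D.range.starProjection_inner_eq_zero _ _ ⟨v', rfl⟩
  have hle : c * ‖w‖ ≤ ‖D v‖ := by simpa only [sub_sub_cancel] using hG w _ horth
  have hpos : 0 < ‖D v‖ := (mul_pos hc (norm_pos_iff.2 hw)).trans_le hle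
  refine ⟨v, fun hv0 => ?_, ?_⟩
  · rw [hv0, map_zero, norm_zero] at hpos
    exact lt_irrefl 0 hpos
  · calc c / d * ‖w‖ * ‖v‖ = c * ‖w‖ * (‖v‖ / d) := by ring
      _ ≤ ‖D v‖ * ‖D v‖ := mul_le_mul hle ((div_le_iff₀' hd).2 (hD v)) (by positivity) hpos.le
      _ = inner ℝ (G w) (D v) := by
          rw [← real_inner_self_eq_norm_mul_norm, ← sub_eq_zero, ← inner_sub_left,
            ← neg_eq_zero, ← inner_neg_left, neg_sub]
          exact horth v

theorem exists_mem_range_forall_inner_eq [CompleteSpace V] [CompleteSpace Y]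
    (hD : ∀ v, ‖v‖ ≤ d * ‖D v‖) (f : StrongDual ℝ V) :
    ∃ m ∈ D.range, ∀ v, inner ℝ m (D v) = f v := by
  have := completeSpace_range_of_bound hD
  let E := D.equivRange (injective_of_bound hD) (isComplete_range_of_bound hD).isClosed
  let m := (InnerProductSpace.toDual ℝ D.range).symm (f.comp E.symm.toContinuousLinearMap)
  refine ⟨m, m.2, fun v => ?_⟩
  calc inner ℝ (m : Y) (D v) = inner ℝ m (E v) := rfl
    _ = f (E.symm (E v)) := InnerProductSpace.toDual_symm_apply
    _ = f v := by rw [E.symm_apply_apply]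

theorem exists_forall_inner_eq_inner [CompleteSpace X] [CompleteSpace V]
    (hD : ∀ v, ‖v‖ ≤ d * ‖D v‖) (hc : 0 < c)
    (hG : ∀ w y, (∀ v, inner ℝ y (D v) = 0) → c * ‖w‖ ≤ ‖G w - y‖)
    (hinj : ∀ v, (∀ w, inner ℝ (G w) (D v) = 0) → v = 0) {m : Y} (hm : m ∈ D.range) :
    ∃ u, ∀ v, inner ℝ (G u) (D v) = inner ℝ m (D v) := by
  have := completeSpace_range_of_bound hD
  let T : X →L[ℝ] D.range := D.range.orthogonalProjectionOnto.comp G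
  have hT_inner (w : X) (v : V) : inner ℝ (T w : Y) (D v) = inner ℝ (G w) (D v) := by
    have h := D.range.starProjection_inner_eq_zero (G w) (D v) ⟨v, rfl⟩
    rw [inner_sub_left, sub_eq_zero] at h
    exact h.symm
  have hT_bound (w : X) : ‖w‖ ≤ c⁻¹ * ‖T w‖ := by
    have h := hG w (G w - T w) fun v => by rw [inner_sub_left, hT_inner, sub_self]
    rw [sub_sub_cancel] at h
    exact (le_inv_mul_iff₀ hc).2 h
  have := completeSpace_range_of_bound hT_bound
  have hT_range : T.range = ⊤ := by
    refine Submodule.orthogonal_eq_bot_iff.1 ((Submodule.eq_bot_iff _).2 ?_)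
    rintro ⟨_, v, rfl⟩ hv
    have hv0 : v = 0 := hinj v fun w => (hT_inner w v).symm.trans (hv _ ⟨w, rfl⟩)
    exact Subtype.ext (by rw [hv0]; exact map_zero D)
  obtain ⟨u, hu⟩ : (⟨m, hm⟩ : D.range) ∈ T.range := hT_range ▸ Submodule.mem_top
  refine ⟨u, fun v => ?_⟩
  rw [← hT_inner]
  exact congrArg (fun y : D.range => inner ℝ (y : Y) (D v)) hu

theorem exists_forall_inner_eq [CompleteSpace X] [CompleteSpace V] [CompleteSpace Y]
    (hD : ∀ v, ‖v‖ ≤ d * ‖D v‖) (hc : 0 < c)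
    (hG : ∀ w y, (∀ v, inner ℝ y (D v) = 0) → c * ‖w‖ ≤ ‖G w - y‖)
    (hinj : ∀ v, (∀ w, inner ℝ (G w) (D v) = 0) → v = 0) (f : StrongDual ℝ V) :
    ∃ u, ∀ v, inner ℝ (G u) (D v) = f v := by
  obtain ⟨m, hm, hmf⟩ := exists_mem_range_forall_inner_eq hD f
  obtain ⟨u, hu⟩ := exists_forall_inner_eq_inner hD hc hG hinj hm
  exact ⟨u, fun v => (hu v).trans (hmf v)⟩

theorem mul_norm_le_of_forall_inner_eq [CompleteSpace V] (hd : 0 < d)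
    (hD : ∀ v, ‖v‖ ≤ d * ‖D v‖) (hc : 0 < c)
    (hG : ∀ w y, (∀ v, inner ℝ y (D v) = 0) → c * ‖w‖ ≤ ‖G w - y‖) {f : StrongDual ℝ V} {u : X}
    (hu : ∀ v, inner ℝ (G u) (D v) = f v) : c / d * ‖u‖ ≤ ‖f‖ := by
  rcases eq_or_ne u 0 with rfl | hu0
  · rw [norm_zero, mul_zero]
    exact norm_nonneg f
  obtain ⟨v, hv0, hv⟩ := exists_ne_zero_mul_norm_le_inner hd hD hc hG hu0
  rw [hu] at hv
  exact le_of_mul_le_mul_right (hv.trans ((le_abs_self _).trans (f.le_opNorm v)))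
    (norm_pos_iff.2 hv0)

theorem existsUnique_forall_inner_eq [CompleteSpace X] [CompleteSpace V] [CompleteSpace Y]
    (hd : 0 < d) (hD : ∀ v, ‖v‖ ≤ d * ‖D v‖) (hc : 0 < c)
    (hG : ∀ w y, (∀ v, inner ℝ y (D v) = 0) → c * ‖w‖ ≤ ‖G w - y‖)
    (hinj : ∀ v, (∀ w, inner ℝ (G w) (D v) = 0) → v = 0) (f : StrongDual ℝ V) :
    ∃! u, ∀ v, inner ℝ (G u) (D v) = f v := by
  obtain ⟨u, hu⟩ := exists_forall_inner_eq hD hc hG hinj f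
  refine ⟨u, hu, fun u' hu' => sub_eq_zero.1 (norm_le_zero_iff.1 ?_)⟩
  have hdiff (v : V) : inner ℝ (G (u' - u)) (D v) = (0 : StrongDual ℝ V) v := by
    rw [map_sub, inner_sub_left, hu, hu', sub_self, zero_apply]
  have hle := mul_norm_le_of_forall_inner_eq hd hD hc hG hdiff
  rw [ContinuousLinearMap.opNorm_zero] at hle
  exact nonpos_of_mul_nonpos_right hle (div_pos hc hd)

end InfSup

theorem IsTestFunction.seminormSq_le_integral_sq_add {φ : ℝ → ℝ} {μ ν : ℝ}
    (hφ : IsTestFunction φ) (h0 : 0 ≤ μ) (hμν : μ ≤ ν) :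
    seminormSq μ φ ≤ (∫ x, φ x ^ 2) + seminormSq ν φ := by
  have hint {s : ℝ} (hs : 0 ≤ s) :=
    hφ.integrable_rpow_mul_norm_fhat_sq (mul_nonneg zero_le_two hs)
  rw [hφ.integral_sq_eq_fhat, seminormSq, seminormSq,
    ← integral_add hφ.integrable_norm_fhat_sq (hint (h0.trans hμν))]
  refine integral_mono (hint h0) (hφ.integrable_norm_fhat_sq.add (hint (h0.trans hμν)))
    fun ξ => ?_
  refine (mul_le_mul_of_nonneg_right ?_ (sq_nonneg _)).trans_eq (one_add_mul _ _)
  exact abs_rpow_le_one_add_abs_rpow (by linarith) (by linarith) _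

section Inclusion

variable {μ ν : ℝ} (h0 : 0 ≤ μ) (hμν : μ ≤ ν)

theorem norm_testEmbedding_le_two_mul (φ : testFunctions) :
    ‖testEmbedding h0 φ‖ ≤ 2 * ‖testEmbedding (h0.trans hμν) φ‖ := by
  refine le_of_sq_le_sq ?_ (by positivity)
  rw [mul_pow, norm_sq_testEmbedding, norm_sq_testEmbedding]
  have hL2 : 0 ≤ ∫ x, φ.1 x ^ 2 := integral_nonneg fun _ => sq_nonneg _
  linarith [φ.2.seminormSq_le_integral_sq_add h0 hμν, seminormSq_nonneg ν φ.1]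

/-- The continuous inclusion `H^ν_0(0,1) ⊆ H^μ_0(0,1)` for `μ ≤ ν`, obtained by extending the
identity of `C_0^∞(0,1)`. -/
def sobolevInclusion : SobolevZero ν →L[ℝ] SobolevZero μ :=
  (testEmbedding h0).extendOfNorm (testEmbedding (h0.trans hμν))

theorem sobolevInclusion_testEmbedding (φ : testFunctions) :
    sobolevInclusion h0 hμν (testEmbedding (h0.trans hμν) φ) = testEmbedding h0 φ :=
  LinearMap.extendOfNorm_eq (denseRange_testEmbedding _)
    ⟨2, norm_testEmbedding_le_two_mul h0 hμν⟩ φ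

end Inclusion

section Coercivity

variable {β θ : ℝ}

theorem infSupConst_mul_norm_le_norm_fracCLM_sub_smul (hβ : 0 < β) (hβ1 : β < 1 / 2)
    (hθ : θ ∈ Icc (0 : ℝ) 1) (w : SobolevZero (1 - β)) (c : ℝ) :
    infSupConst β / 2 * ‖w‖ ≤ ‖fracCLM hβ (by linarith) θ w - c • oneUnit‖ := by
  refine (denseRange_testEmbedding (by linarith : 0 ≤ 1 - β)).induction_on
    (p := fun w => infSupConst β / 2 * ‖w‖ ≤ ‖fracCLM hβ _ θ w - c • oneUnit‖) w
    (isClosed_le (by fun_prop) (by fun_prop)) fun φ => ?_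
  rw [fracCLM_testEmbedding hβ _ hθ]
  refine le_trans ?_ (infSupConst_mul_le_norm_convTest_sub_smul hβ hβ1 hθ φ c)
  rw [div_mul_eq_mul_div, mul_div_assoc]
  refine mul_le_mul_of_nonneg_left ?_ (infSupConst_pos hβ hβ1).le
  exact (div_le_iff₀' two_pos).2 (norm_le_two_mul_sqrt_seminormSq _ φ)

theorem infSupConst_mul_norm_le_norm_fracCLM_sub (hβ : 0 < β) (hβ1 : β < 1 / 2)
    (hθ : θ ∈ Icc (0 : ℝ) 1) (w : SobolevZero (1 - β)) (y : L2Unit)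
    (hy : ∀ v, inner ℝ y (derivCLM v) = 0) :
    infSupConst β / 2 * ‖w‖ ≤ ‖fracCLM hβ (by linarith) θ w - y‖ := by
  obtain ⟨c, rfl⟩ := exists_eq_smul_oneUnit fun φ => by
    rw [← derivCLM_testEmbedding]
    exact hy _
  exact infSupConst_mul_norm_le_norm_fracCLM_sub_smul hβ hβ1 hθ w c

theorem cos_mul_integral_sq_le_inner_convTest (hβ : 0 < β) (hβ1 : β ≤ 1)
    (hθ : θ ∈ Icc (0 : ℝ) 1) (φ : testFunctions) :
    cos (π * β / 2) / 2 * ∫ x, φ.1 x ^ 2 ≤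
      inner ℝ (convTest (integrable_twoSidedKernel hβ θ) φ) (derivTest φ) := by
  have hcos : 0 ≤ cos (π * β / 2) :=
    cos_nonneg_of_mem_Icc ⟨by nlinarith [pi_pos], by nlinarith [pi_pos]⟩
  have hL2 : cos (π * β / 2) / 2 * ∫ x, φ.1 x ^ 2 ≤
      cos (π * β / 2) * seminormSq (1 - β / 2) φ.1 := by
    rw [div_mul_eq_mul_div, mul_div_assoc]
    refine mul_le_mul_of_nonneg_left ?_ hcos
    exact (div_le_iff₀' two_pos).2 (φ.2.integral_sq_le_seminormSq (by linarith))
  have hinner {K : ℝ → ℝ} (hK : Integrable K) : inner ℝ (convTest hK φ) (derivTest φ) =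
      ∫ x in Ioo (0 : ℝ) 1, deriv φ.1 x * conv K (deriv φ.1) x := by
    rw [real_inner_comm]
    exact inner_toLp_toLp (memLp_unit_of_continuous φ.2.deriv.continuous)
      (φ.2.memLp_conv_deriv hK)
  rw [convTest_twoSidedKernel hβ, inner_add_left, real_inner_smul_left, real_inner_smul_left,
    hinner, hinner]
  have hleft := mul_le_mul_of_nonneg_left
    (cos_mul_seminormSq_le_integral_mul_conv hβ (hβ1.trans one_le_two) φ.2) hθ.1
  have hright := mul_le_mul_of_nonneg_left
    (cos_mul_seminormSq_le_integral_mul_conv_refl hβ (hβ1.trans one_le_two) φ.2)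
    (sub_nonneg.2 hθ.2)
  linarith

theorem cos_mul_norm_sq_le_pgForm (hβ : 0 < β) (hβ1 : β ≤ 1) (hθ : θ ∈ Icc (0 : ℝ) 1)
    (v : SobolevZero 1) :
    cos (π * β / 2) / 2 * ‖SobolevR.toL2CLM (v : SobolevR 1)‖ ^ 2 ≤
      pgForm β θ (sobolevInclusion (sub_nonneg.2 hβ1) (sub_le_self 1 hβ.le) v) v := by
  rw [pgForm_eq_inner hβ hβ1 hθ]
  refine (denseRange_testEmbedding zero_le_one).induction_on
    (p := fun v : SobolevZero 1 => cos (π * β / 2) / 2 *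
      ‖SobolevR.toL2CLM (v : SobolevR 1)‖ ^ 2 ≤ inner ℝ (fracCLM hβ hβ1 θ
        (sobolevInclusion (sub_nonneg.2 hβ1) (sub_le_self 1 hβ.le) v)) (derivCLM v)) v
    (isClosed_le (by fun_prop) (by fun_prop)) fun φ => ?_
  have hnorm : ‖SobolevR.toL2CLM (testEmbedding zero_le_one φ : SobolevR 1)‖ ^ 2 =
      ∫ x, φ.1 x ^ 2 :=
    (norm_sq_toLp φ.2.memLp_two).trans (by simp only [Real.norm_eq_abs, sq_abs])
  rw [hnorm, sobolevInclusion_testEmbedding, fracCLM_testEmbedding hβ hβ1 hθ,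
    derivCLM_testEmbedding]
  exact cos_mul_integral_sq_le_inner_convTest hβ hβ1 hθ φ

theorem exists_pgForm_pos (hβ : 0 < β) (hβ1 : β < 1) (hθ : θ ∈ Icc (0 : ℝ) 1)
    {v : SobolevZero 1} (hv : v ≠ 0) : ∃ w, 0 < pgForm β θ w v := by
  have hcos : 0 < cos (π * β / 2) :=
    cos_pos_of_mem_Ioo ⟨by nlinarith [pi_pos], by nlinarith [pi_pos]⟩
  have hv_toL2 : SobolevR.toL2CLM (v : SobolevR 1) ≠ 0 := fun h =>
    hv (Subtype.ext (SobolevR.toL2_injective (h.trans (map_zero _).symm)))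
  refine ⟨_, lt_of_lt_of_le ?_ (cos_mul_norm_sq_le_pgForm hβ hβ1.le hθ v)⟩
  exact mul_pos (half_pos hcos) (pow_pos (norm_pos_iff.2 hv_toL2) 2)

end Coercivity

section WeakCoercivity

variable {β θ : ℝ} (hβ : 0 < β) (hβ1 : β < 1 / 2) (hθ : θ ∈ Icc (0 : ℝ) 1)

include hβ hβ1 hθ

theorem exists_ne_zero_le_pgForm {w : SobolevZero (1 - β)} (hw : w ≠ 0) :
    ∃ v ≠ 0, infSupConst β / 2 / 2 * ‖w‖ * ‖v‖ ≤ pgForm β θ w v := by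
  simp only [pgForm_eq_inner hβ (by linarith : β ≤ 1) hθ]
  exact exists_ne_zero_mul_norm_le_inner two_pos norm_le_two_mul_norm_derivCLM
    (half_pos (infSupConst_pos hβ hβ1)) (infSupConst_mul_norm_le_norm_fracCLM_sub hβ hβ1 hθ) hw

theorem le_iInf_iSup_pgForm :
    ((infSupConst β / 2 / 2 : ℝ) : EReal) ≤
      ⨅ w : {w : SobolevZero (1 - β) // w ≠ 0}, ⨆ v : {v : SobolevZero 1 // v ≠ 0},
        ((pgForm β θ w v / (‖(w : SobolevZero (1 - β))‖ * ‖(v : SobolevZero 1)‖) : ℝ) :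
          EReal) := by
  refine le_iInf fun ⟨w, hw⟩ => ?_
  obtain ⟨v, hv, hle⟩ := exists_ne_zero_le_pgForm hβ hβ1 hθ hw
  refine le_iSup_of_le ⟨v, hv⟩ (EReal.coe_le_coe_iff.2 ?_)
  rwa [le_div_iff₀ (mul_pos (norm_pos_iff.2 hw) (norm_pos_iff.2 hv)), ← mul_assoc]

theorem norm_le_of_isPGSolution {f : SobolevMinusOne} {u : SobolevZero (1 - β)}
    (hu : IsPGSolution β θ f u) : ‖u‖ ≤ 1 / (infSupConst β / 2 / 2) * ‖f‖ := by
  have hc := infSupConst_pos hβ hβ1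
  rw [one_div, le_inv_mul_iff₀ (half_pos (half_pos hc))]
  refine mul_norm_le_of_forall_inner_eq two_pos norm_le_two_mul_norm_derivCLM (half_pos hc)
    (infSupConst_mul_norm_le_norm_fracCLM_sub hβ hβ1 hθ) fun v => ?_
  rw [← pgForm_eq_inner _ _ hθ, hu v]

theorem existsUnique_isPGSolution (f : SobolevMinusOne) : ∃! u, IsPGSolution β θ f u := by
  simp only [IsPGSolution, pgForm_eq_inner hβ (by linarith : β ≤ 1) hθ]
  refine existsUnique_forall_inner_eq two_pos norm_le_two_mul_norm_derivCLM
    (half_pos (infSupConst_pos hβ hβ1)) (infSupConst_mul_norm_le_norm_fracCLM_sub hβ hβ1 hθ)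
    (fun v hv => ?_) f
  by_contra hv0
  obtain ⟨w, hw⟩ := exists_pgForm_pos hβ (by linarith) hθ hv0
  rw [pgForm_eq_inner hβ (by linarith) hθ, hv w] at hw
  exact lt_irrefl 0 hw

end WeakCoercivity

end FracPG

end

theorem theorem5p1 (β : ℝ) (hβ0 : 0 < β) (hβ : β < 1 / 2) :
    ∃ κ C : ℝ, 0 < κ ∧ ∀ θ : ℝ, 0 ≤ θ → θ ≤ 1 →
      -- the functions entering the form lie in `H^1(0,1)`, so that the form is well defined
      (∀ w : FracPG.SobolevZero (1 - β),
        FracPG.MemSobolevOne (FracPG.twoSidedFracInt β θ w.fn)) ∧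
      (∀ v : FracPG.SobolevZero 1, FracPG.MemSobolevOne v.fn) ∧
      -- the form is bilinear and bounded
      (∃ A : FracPG.SobolevZero (1 - β) →ₗ[ℝ] FracPG.SobolevZero 1 →ₗ[ℝ] ℝ,
        (∀ w v, A w v = FracPG.pgForm β θ w v) ∧
        ∀ w v, |A w v| ≤ C * ‖w‖ * ‖v‖) ∧
      -- weak coercivity
      ((κ : EReal) ≤ ⨅ w : {w : FracPG.SobolevZero (1 - β) // w ≠ 0},
        ⨆ v : {v : FracPG.SobolevZero 1 // v ≠ 0},
          ((FracPG.pgForm β θ w v / (‖(w : FracPG.SobolevZero (1 - β))‖ *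
            ‖(v : FracPG.SobolevZero 1)‖) : ℝ) : EReal)) ∧
      (∀ v : FracPG.SobolevZero 1, v ≠ 0 →
        (0 : EReal) < ⨆ w : FracPG.SobolevZero (1 - β), (FracPG.pgForm β θ w v : EReal)) ∧
      -- well-posedness
      ∀ f : FracPG.SobolevMinusOne,
        (∃! u : FracPG.SobolevZero (1 - β), FracPG.IsPGSolution β θ f u) ∧
        ∀ u : FracPG.SobolevZero (1 - β), FracPG.IsPGSolution β θ f u →
          ‖u‖ ≤ 1 / κ * ‖f‖ := by
  refine ⟨FracPG.infSupConst β / 2 / 2, 1,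
    half_pos (half_pos (FracPG.infSupConst_pos hβ0 hβ)), fun θ h0 h1 => ?_⟩
  have hθ : θ ∈ Icc (0 : ℝ) 1 := ⟨h0, h1⟩
  have hβ1 : β < 1 := by linarith
  refine ⟨FracPG.memSobolevOne_twoSidedFracInt hβ0 hβ1.le hθ, FracPG.memSobolevOne_fn, ?_,
    FracPG.le_iInf_iSup_pgForm hβ0 hβ hθ, fun v hv => ?_, fun f =>
      ⟨FracPG.existsUnique_isPGSolution hβ0 hβ hθ f,
        fun u hu => FracPG.norm_le_of_isPGSolution hβ0 hβ hθ hu⟩⟩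
  · obtain ⟨A, hA⟩ := FracPG.exists_bilin_eq_pgForm hβ0 hβ1.le hθ
    refine ⟨A, hA, fun w v => ?_⟩
    rw [hA, one_mul]
    exact FracPG.abs_pgForm_le hβ0 hβ1.le hθ w v
  · obtain ⟨w, hw⟩ := FracPG.exists_pgForm_pos hβ0 hβ1 hθ hv
    exact lt_iSup_iff.2 ⟨w, EReal.coe_pos.2 hw⟩
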